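/- **Setting.** Let $\mathfrak g$ be a finite-dimensional complex simple Lie algebra with Cartan subalgebra $\mathfrak h$, root system $\Sigma\subset\mathfrak h^*$, simple roots $\alpha_1,\dots,\alpha_r$, positive roots $\Sigma_+$, maximal root $\theta$, and a nondegenerate invariant symmetric bilinear form $(\,,\,)$, used to identify $\mathfrak h$ with $\mathfrak h^*$. Put $\alpha^\vee=2\alpha/(\alpha,\alpha)$. Let $\omega_i^\vee$ be the dual fundamental weights, $(\omega_i^\vee,\alpha_j)=\delta_{ij}$, and $P^\vee=\bigoplus_i\mathbb Z\omega_i^\vee$. Choose $e_\alpha\in\mathfrak g_\alpha$ with $(e_\alpha,e_{-\alpha})=1$ and put $H_\alpha=\alpha^\vee$, $E_\alpha=\frac{2}{(\alpha,\alpha)}e_\alpha$, $F_\alpha=e_{-\alpha}$. Let $x_1,\dots,x_r$ be an orthonormal basis of $\mathfrak h$ and $$\Omega^{\pm}=\tfrac12\sum_i x_i\otimes x_i+\sum_{\alpha\in\Sigma_+}e_{\pm\alpha}\otimes e_{\mp\alpha},\qquad \Omega=\Omega^++\Omega^-,\qquad r(z)=\frac{\Omega^+z+\Omega^-}{z-1}.$$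 Let $V=V_1\otimes\dots\otimes V_n$ be a tensor product of finite-dimensional $\mathfrak g$-modules, $V[\nu]$ a weight subspace with basis $v_1,\dots,v_d$, and $\kappa\in\mathbb C$, $\kappa\neq0$. A superscript $(k)$ or $(k,l)$ indicates the tensor factors in which an operator acts. **Equations.** The variable $z=(z_1,\dots,z_n)$ ranges over a connected space spread over $\{z\in\mathbb C^n: z_k\ne0,\ z_k\neq z_l \text{ for } k\ne l\}$ by a local homeomorphism (for instance the universal cover), on which continuous branches of all $\log z_k$ and of all $\log(z_k-z_l)$, $k<l$, are fixed and used to define powers; $\lambda\in\mathfrak h$. The trigonometric KZ equations are $$\kappa z_k\frac{\partial u}{\partial z_k}=\sum_{l\ne k}r(z_k/z_l)^{(k,l)}u+\lambda^{(k)}u,\qquad k=1,\dots,n .$$ For $\alpha\in\Sigma$ define $\mathbb B^\alpha_V(\lambda)$ on $V[\mu]$ by $$\mathbb B_V^\alpha(\lambda)v=\sum_{m\ge0}F_\alpha^mE_\alpha^m\frac1{m!}\prod_{j=0}^{m-1}\frac1{t-H_\alpha-j}\,v,\qquad t=(\lambda+\tfrac12\mu,\alpha^\vee)-1 .$$ For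 an affine root $[\alpha,j]$, $\alpha\in\Sigma$, $j\in\mathbb Z$, put $$\tilde G^{[\alpha,j]}(z,\lambda)=\prod_kz_k^{\omega^{(k)}}\,\mathbb B_V^\alpha(\lambda-\kappa\omega)\,\prod_kz_k^{-\omega^{(k)}},\qquad \omega\in P^\vee,\ (\omega,\alpha)=-j .$$ Let $s_{[\beta,m]}[\alpha,j]=[s_\beta\alpha,\,j-(\alpha,\beta^\vee)m]$ and $t_\omega[\alpha,j]=[\alpha,j-(\omega,\alpha)]$. The simple affine roots are $\alpha_0=[-\theta,1]$ and $\alpha_i=[\alpha_i,0]$, $1\le i\le r$; write $s_j=s_{\alpha_j}$, $0\le j\le r$. Given a reduced presentation $t_{\omega_i^\vee}=\pi s_{j_l}\cdots s_{j_1}$ ($\pi$ permutes the simple affine roots, and $s_{j_l}\cdots s_{j_1}$ is a reduced word in the affine Weyl group), set $$\tilde G_{t_{\omega_i^\vee}}=\tilde G^{\tilde\alpha^l}\cdots\tilde G^{\tilde\alpha^1},\qquad \tilde\alpha^1=\alpha_{j_1},\quad \tilde\alpha^m=s_{j_1}\cdots s_{j_{m-1}}(\alpha_{j_m}) .$$ The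 dynamical difference equations are $$\prod_kz_k^{-(\omega_i^\vee)^{(k)}}u(z,\lambda+\kappa\omega_i^\vee)=\tilde G_{t_{\omega_i^\vee}}(z,\lambda)\,u(z,\lambda),\qquad i=1,\dots,r .$$ **The function $D$.** For $\alpha\in\Sigma_+$ let $V[\nu]_\alpha$ be the submodule generated by $V[\nu]$ for the $sl_2$-triple $H_\alpha,E_\alpha,F_\alpha$, and let $d^\alpha_k$ be the multiplicity in it of the irreducible module of highest weight $\nu+k\alpha$. Put $$X_{\alpha,V[\nu]}(\lambda)=\prod_{k\ge0}\Bigl(\prod_{j=1}^k\frac{\Gamma\bigl(1-\frac{(\lambda-\frac12(\nu+j\alpha),\alpha)}{\kappa}\bigr)}{\Gamma\bigl(1-\frac{(\lambda+\frac12(\nu+j\alpha),\alpha)}{\kappa}\bigr)}\Bigr)^{d^\alpha_k},$$ $\Lambda_k(\lambda)=\operatorname{tr}_{V[\nu]}\lambda^{(k)}$, $\epsilon_{k,l}=\operatorname{tr}_{V[\nu]}\Omega^{(k,l)}$, $\gamma_k=\sum_{l\ne k}\epsilon_{k,l}$, and $$D_{V[\nu]}(z,\lambda)=\prod_{k=1}^nz_k^{\frac{\Lambda_k(\lambda)}{\kappa}-\frac{\gamma_k}{2\kappa}}\prod_{1\le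 k<l\le n}(z_k-z_l)^{\frac{\epsilon_{k,l}}{\kappa}}\prod_{\alpha\in\Sigma_+}X_{\alpha,V[\nu]}(\lambda).$$ Call $\lambda$ regular if no denominator of $\mathbb B^\alpha_V$ on $V[\nu]$, $\alpha\in\Sigma_+$, vanishes on $\lambda+\kappa P^\vee$: that is, $(\lambda-\frac12(\nu+j\alpha),\alpha)\notin\kappa\mathbb Z$ whenever $\alpha\in\Sigma_+$, $1\le j\le k$ and $d_k^\alpha\ne0$. **Statement.** Let $S\subset\mathfrak h$ be any set of regular $\lambda$ with $S+\kappa P^\vee\subset S$. Let $u_i(z,\lambda)=\sum_{j=1}^du_{i,j}(z,\lambda)v_j$, $i=1,\dots,d$, be $V[\nu]$-valued functions which for $\lambda\in S$ solve the combined system of KZ equations and dynamical difference equations. Then there is a function $C_{V[\nu]}$ of $\lambda\in\mathfrak h$ alone such that $$C_{V[\nu]}(\lambda+\kappa\omega)=C_{V[\nu]}(\lambda)\quad\text{for all }\omega\in P^\vee,$$ $$\det\bigl(u_{i,j}(z,\lambda)\bigr)_{1\le i,j\le d}=C_{V[\nu]}(\lambda)\,D_{V[\nu]}(z,\lambda)\quad\text{for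 all }z\text{ and all }\lambda\in S .$$ In particular this holds for $\mathfrak g=sl_N$, where all $\omega_i^\vee$ are minuscule. -/

import Mathlib

open LieAlgebra LieModule Module
open scoped TensorProduct

noncomputable section

namespace KZDyn

variable {L : Type*} [LieRing L] [LieAlgebra ℂ L] [FiniteDimensional ℂ L] [LieAlgebra.IsSimple ℂ L]

/-- The choices made once and for all for a simple Lie algebra `L` with Cartan subalgebra `H`:
an invariant scalar product, simple roots, root vectors `e_α` with `(e_α, e_{-α}) = 1`,
an orthonormal basis `x_1, …, x_r` of `H`, and the maximal root `θ`. -/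
structure RootData (H : LieSubalgebra ℂ L) [H.IsCartanSubalgebra] where
  /-- the invariant scalar product `( , )` on `L` -/
  form : LinearMap.BilinForm ℂ L
  form_symm : form.IsSymm
  form_invariant : form.lieInvariant L
  form_nondegenerate : form.Nondegenerate
  /-- the system of simple roots -/
  base : (IsKilling.rootSystem H).Base
  /-- the root vectors `e_α` -/
  e : H.root → L
  e_mem : ∀ α : H.root, e α ∈ LieAlgebra.rootSpace H (α : Weight ℂ H L)
  e_pair : ∀ α : H.root, form (e α) (e ((IsKilling.rootSystem H).reflectionPerm α α)) = 1
  /-- the orthonormal basis `x_1, …, x_r` of `H` -/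
  x : Basis (Fin (finrank ℂ H)) ℂ H
  x_orthonormal : ∀ i j, form (x i : L) (x j : L) = if i = j then 1 else 0
  /-- the maximal root -/
  θ : H.root
  θ_maximal : ∀ α : H.root, ∃ c : base.support → ℕ,
    (IsKilling.rootSystem H).root θ =
      (IsKilling.rootSystem H).root α + ∑ i, c i • (IsKilling.rootSystem H).root i

namespace RootData

variable {H : LieSubalgebra ℂ L} [H.IsCartanSubalgebra] (D : RootData H)

/-! ### Roots and coweights -/

/-- A root, as a linear function on `H`. -/
def rt (_ : RootData H) (α : H.root) : Dual ℂ H := (IsKilling.rootSystem H).root α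

/-- The root `-α`. -/
def neg (_ : RootData H) (α : H.root) : H.root := (IsKilling.rootSystem H).reflectionPerm α α

/-- The coroot `α^∨ = H_α`, as an element of `H`. -/
def corootVec (_ : RootData H) (α : H.root) : H := (IsKilling.rootSystem H).coroot α

open scoped Classical in
/-- The set `Σ_+` of positive roots. -/
def posRoots : Finset H.root := Finset.univ.filter fun α => D.base.IsPos α

/-- The map `H → H^*`, `h ↦ (h, ·)`, given by the scalar product. -/
def flat : H →ₗ[ℂ] Dual ℂ H := D.form.domRestrict₁₂ H.toSubmodule H.toSubmodule

lemma flat_injective : Function.Injective D.flat := by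
  rw [injective_iff_map_eq_zero]
  intro h hh
  have key : ∀ y : L, D.form (h : L) y = 0 := by
    intro y
    have hy : y ∈ (⨆ χ : Weight ℂ H L, genWeightSpace L χ : LieSubmodule ℂ H L) := by
      rw [LieModule.iSup_genWeightSpace_eq_top' ℂ H L]; trivial
    induction hy using LieSubmodule.iSup_induction' with
    | mem χ y hy =>
      by_cases hχ : χ.IsZero
      · have hy' : y ∈ LieAlgebra.rootSpace H (0 : H → ℂ) := by
          have : (χ : H → ℂ) = 0 := hχ
          rwa [this] at hy
        rw [LieAlgebra.rootSpace_zero_eq, LieSubalgebra.mem_toLieSubmodule] at hy'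
        exact LinearMap.congr_fun hh ⟨y, hy'⟩
      · obtain ⟨h', hne⟩ : ∃ h' : H, χ h' ≠ 0 := by
          by_contra! hc
          exact hχ (funext hc)
        have h1 : ⁅(h' : L), y⁆ = χ h' • y := IsKilling.lie_eq_smul_of_mem_rootSpace hy h'
        have h2 := D.form_invariant (h' : L) (h : L) y
        have h0 : ⁅(h' : L), (h : L)⁆ = 0 := by
          rw [← LieSubalgebra.coe_bracket, trivial_lie_zero]; rfl
        rw [h0, h1] at h2
        simpa [hne] using h2
    | zero => simp
    | add a b _ _ ha hb => rw [map_add, ha, hb, add_zero]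
  exact Subtype.ext (D.form_nondegenerate.1 _ key)

/-- The identification `H^* → H`, the inverse of `h ↦ (h, ·)`. -/
def sharp (ξ : Dual ℂ H) : H := Function.invFun D.flat ξ

lemma flat_sharp (ξ : Dual ℂ H) : D.flat (D.sharp ξ) = ξ :=
  Function.invFun_eq ((LinearMap.injective_iff_surjective_of_finrank_eq_finrank
    (Subspace.dual_finrank_eq (K := ℂ) (V := H)).symm).1 D.flat_injective ξ)

/-- The scalar product on `H^*`. -/
def dualForm (ξ η : Dual ℂ H) : ℂ := ξ (D.sharp η)

/-- The dual fundamental weights `ω_i^∨ ∈ H`, with `(ω_i^∨, α_j) = δ_{ij}`. -/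
def fundCoweight (i : D.base.support) : H :=
  (Module.evalEquiv ℂ H).symm (D.base.toWeightBasis.coord i)

open scoped Classical in
lemma rt_fundCoweight (i j : D.base.support) :
    D.rt j (D.fundCoweight i) = if j = i then 1 else 0 := by
  have h : D.rt j (D.fundCoweight i) = D.base.toWeightBasis.coord i (D.rt j) := by
    simp [fundCoweight]
  rw [h, rt, ← D.base.toWeightBasis_apply, Basis.coord_apply, Basis.repr_self,
    Finsupp.single_apply]

/-- The dual weight lattice `P^∨ = ⨁ ℤ ω_i^∨`. -/
def coweightLattice : Submodule ℤ H := Submodule.span ℤ (Set.range D.fundCoweight)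

lemma mem_coweightLattice_iff (ω : H) :
    ω ∈ D.coweightLattice ↔ ∀ i : D.base.support, ∃ m : ℤ, D.rt i ω = m := by
  classical
  constructor
  · intro h
    induction h using Submodule.span_induction with
    | mem x hx =>
      obtain ⟨i, rfl⟩ := hx
      intro j
      rw [rt_fundCoweight]
      by_cases hij : j = i
      · exact ⟨1, by simp [hij]⟩
      · exact ⟨0, by simp [hij]⟩
    | zero => exact fun i => ⟨0, by simp⟩
    | add x y _ _ hx hy =>
      intro i
      obtain ⟨a, ha⟩ := hx i
      obtain ⟨b, hb⟩ := hy i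
      exact ⟨a + b, by simp [ha, hb]⟩
    | smul c x _ hx =>
      intro i
      obtain ⟨a, ha⟩ := hx i
      exact ⟨c * a, by simp [ha]⟩
  · intro h
    choose m hm using h
    have key : ω = ∑ i, m i • D.fundCoweight i := by
      rw [← sub_eq_zero, ← Module.forall_dual_apply_eq_zero_iff ℂ]
      intro φ
      have : φ ∈ Submodule.span ℂ (Set.range D.base.toWeightBasis) := by
        rw [Basis.span_eq]; trivial
      induction this using Submodule.span_induction with
      | mem x hx =>
        obtain ⟨j, rfl⟩ := hx
        have := hm j
        have h2 := fun i => D.rt_fundCoweight i j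
        simp only [rt] at this h2
        simp [D.base.toWeightBasis_apply, -IsKilling.rootSystem_root_apply, this, h2, map_sum,
          map_zsmul]
      | zero => simp
      | add x y _ _ hx hy => rw [LinearMap.add_apply, hx, hy, add_zero]
      | smul c x _ hx => rw [LinearMap.smul_apply, hx, smul_zero]
    rw [key]
    exact Submodule.sum_mem _ fun i _ => Submodule.smul_mem _ _ (Submodule.subset_span ⟨i, rfl⟩)

lemma exists_coweight_eq_one (α : H.root) : ∃ ω ∈ D.coweightLattice, D.rt α ω = 1 := by
  classical
  induction α using D.base.induction_reflect with
  | h₀ i h =>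
    obtain ⟨ω, hω, h1⟩ := h
    refine ⟨-ω, neg_mem hω, ?_⟩
    simp only [rt] at h1 ⊢
    rw [RootPairing.root_reflectionPerm, RootPairing.reflection_apply_self]
    simpa using h1
  | h₁ i hi =>
    refine ⟨D.fundCoweight ⟨i, hi⟩, Submodule.subset_span ⟨_, rfl⟩, ?_⟩
    simpa using D.rt_fundCoweight ⟨i, hi⟩ ⟨i, hi⟩
  | h₂ i j h hj =>
    obtain ⟨ω, hω, h1⟩ := h
    refine ⟨ω - D.rt j ω • D.corootVec j, ?_, ?_⟩
    · rw [mem_coweightLattice_iff] at hω ⊢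
      intro k
      obtain ⟨a, ha⟩ := hω k
      obtain ⟨b, hb⟩ := hω ⟨j, hj⟩
      have hp : D.rt k (D.corootVec j) = ((IsKilling.rootSystem H).pairingIn ℤ k j : ℂ) := by
        have := (IsKilling.rootSystem H).algebraMap_pairingIn ℤ (k : H.root) j
        simp only [algebraMap_int_eq, eq_intCast] at this
        rw [this]; rfl
      refine ⟨a - b * (IsKilling.rootSystem H).pairingIn ℤ k j, ?_⟩
      simp only [map_sub, map_smul, smul_eq_mul, hp, ha]
      rw [hb]
      push_cast
      rfl
    · simp only [rt] at h1 ⊢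
      rw [RootPairing.root_reflectionPerm, RootPairing.reflection_apply]
      simp only [LinearMap.sub_apply, LinearMap.smul_apply, map_sub, map_smul, h1, smul_eq_mul,
        corootVec]
      have h2 : (IsKilling.rootSystem H).root j ((IsKilling.rootSystem H).coroot j) = 2 := by
        simpa using (IsKilling.rootSystem H).root_coroot_two j
      have h3 : (IsKilling.rootSystem H).root i ((IsKilling.rootSystem H).coroot j) =
        ((IsKilling.rootSystem H).coroot' j) ((IsKilling.rootSystem H).root i) := rfl
      rw [h2, h3]
      ring

lemma exists_shift (α : H.root) (j : ℤ) : ∃ ω ∈ D.coweightLattice, D.rt α ω = -(j : ℂ) := by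
  obtain ⟨ω, hω, h⟩ := D.exists_coweight_eq_one α
  exact ⟨(-j) • ω, Submodule.smul_mem _ _ hω, by simp [h]⟩

/-- For a root `α` and `j ∈ ℤ`, an element `ω ∈ P^∨` with `(ω, α) = -j`. -/
def shift (α : H.root) (j : ℤ) : H := (D.exists_shift α j).choose

/-! ### The affine root system and reduced presentations -/

/-- The affine roots `[α, j]`, `α ∈ Σ`, `j ∈ ℤ`. -/
abbrev AffRoot (_ : RootData H) : Type _ := H.root × ℤ

/-- The affine reflection `s_β̃(α̃) = α̃ - (α, β^∨) β̃`. -/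
def affRefl (β α : D.AffRoot) : D.AffRoot :=
  ((IsKilling.rootSystem H).reflectionPerm β.1 α.1,
    α.2 - (IsKilling.rootSystem H).pairingIn ℤ α.1 β.1 * β.2)

/-- The simple affine roots: `none` is `α_0 = [-θ, 1]`, and `some i` is `α_i = [α_i, 0]`. -/
def simpleAff : Option D.base.support → D.AffRoot
  | none => (D.neg D.θ, 1)
  | some i => (i, 0)

/-- The action of `s_{j_l} ⋯ s_{j_1}` on affine roots, for the word `[j_1, …, j_l]`. -/
def wordAct : List (Option D.base.support) → D.AffRoot → D.AffRoot
  | [], a => a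
  | j :: js, a => wordAct js (D.affRefl (D.simpleAff j) a)

/-- The affine roots `α̃^1 = α_{j_1}`, `α̃^2 = s_{j_1}(α_{j_2})`, `α̃^3 = s_{j_1} s_{j_2}(α_{j_3})`, …
of the word `[j_1, …, j_l]`. -/
def wordRoots : List (Option D.base.support) → List D.AffRoot
  | [] => []
  | j :: js => D.simpleAff j :: (wordRoots js).map (D.affRefl (D.simpleAff j))

/-- `[j_1, …, j_l]` gives a reduced presentation `t_ω = π s_{j_l} ⋯ s_{j_1}`: here
`t_ω [α, j] = [α, j - (ω, α)]`, the element `π = t_ω (s_{j_l} ⋯ s_{j_1})⁻¹` of the extended affine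
Weyl group has length zero, i.e. permutes the simple affine roots, and the word is a shortest one
for `s_{j_l} ⋯ s_{j_1}` in the affine Weyl group. -/
def IsReducedPresentation (ω : H) (js : List (Option D.base.support)) : Prop :=
  (∃ π : D.AffRoot → D.AffRoot,
    π '' Set.range D.simpleAff = Set.range D.simpleAff ∧
    ∀ a : D.AffRoot, (π (D.wordAct js a)).1 = a.1 ∧
      ((π (D.wordAct js a)).2 : ℂ) = a.2 - D.rt a.1 ω) ∧
  ∀ js', D.wordAct js' = D.wordAct js → js.length ≤ js'.length

end RootData

/-! ### Operators on the tensor product `V = V_1 ⊗ ⋯ ⊗ V_n` -/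

section Operators

variable {n : ℕ} (V : Fin n → Type*) [∀ k, AddCommGroup (V k)] [∀ k, Module ℂ (V k)]
  [∀ k, LieRingModule L (V k)] [∀ k, LieModule ℂ L (V k)] [∀ k, FiniteDimensional ℂ (V k)]

/-- `a^{(k)}`: the operator `a` acting in the `k`-th factor. -/
def inFactor (k : Fin n) (a : End ℂ (V k)) : End ℂ (⨂[ℂ] i, V i) :=
  PiTensorProduct.map (Function.update (fun _ => LinearMap.id) k a)

/-- `y^{(k)}`: the element `y` of the Lie algebra acting in the `k`-th factor. -/
def factorAct (k : Fin n) (y : L) : End ℂ (⨂[ℂ] i, V i) := inFactor V k (toEnd ℂ L (V k) y)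

/-- `Δ^{(n)}(y) = y^{(1)} + ⋯ + y^{(n)}`. -/
def totalAct (y : L) : End ℂ (⨂[ℂ] i, V i) := ∑ k, factorAct V k y

lemma inFactor_mul (k : Fin n) (a b : End ℂ (V k)) :
    inFactor V k (a * b) = inFactor V k a * inFactor V k b := by
  rw [inFactor, inFactor, inFactor, ← PiTensorProduct.map_mul]
  congr 1
  funext i
  by_cases h : i = k
  · subst h; simp
  · simp only [Function.update_of_ne h]; rfl

lemma inFactor_comm {k l : Fin n} (h : k ≠ l) (a : End ℂ (V k)) (b : End ℂ (V l)) :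
    inFactor V k a * inFactor V l b = inFactor V l b * inFactor V k a := by
  rw [inFactor, inFactor, ← PiTensorProduct.map_mul, ← PiTensorProduct.map_mul]
  congr 1
  funext i
  by_cases hk : i = k
  · subst hk; simp only [Function.update_of_ne h]; rfl
  · by_cases hl : i = l
    · subst hl; simp only [Function.update_of_ne hk]; rfl
    · simp only [Function.update_of_ne hk, Function.update_of_ne hl]

lemma inFactor_sub (k : Fin n) (a b : End ℂ (V k)) :
    inFactor V k (a - b) = inFactor V k a - inFactor V k b := by
  have := PiTensorProduct.map_update_add (R := ℂ) (fun i => (LinearMap.id : V i →ₗ[ℂ] V i)) k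
    (a - b) b
  rw [sub_add_cancel] at this
  rw [inFactor, inFactor, inFactor, this, add_sub_cancel_right]

lemma inFactor_smul (k : Fin n) (c : ℂ) (a : End ℂ (V k)) :
    inFactor V k (c • a) = c • inFactor V k a :=
  PiTensorProduct.map_update_smul (R := ℂ) _ k c a

lemma factorAct_lie (k : Fin n) (y z : L) :
    factorAct V k ⁅y, z⁆ = factorAct V k y * factorAct V k z - factorAct V k z * factorAct V k y := by
  simp only [factorAct, ← inFactor_mul, ← inFactor_sub]
  congr 1
  ext w
  simp

lemma factorAct_smul (k : Fin n) (c : ℂ) (y : L) :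
    factorAct V k (c • y) = c • factorAct V k y := by
  simp only [factorAct, ← inFactor_smul, map_smul]

lemma totalAct_factorAct (k : Fin n) (y z : L) :
    totalAct V y * factorAct V k z = factorAct V k z * totalAct V y + factorAct V k ⁅y, z⁆ := by
  rw [totalAct, Finset.sum_mul, Finset.mul_sum, ← sub_eq_iff_eq_add', ← Finset.sum_sub_distrib,
    Finset.sum_eq_single k]
  · rw [factorAct_lie]
  · intro l _ hl
    rw [factorAct, factorAct, inFactor_comm V hl, sub_self]
  · simp

variable (H : LieSubalgebra ℂ L) [H.IsCartanSubalgebra]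

/-- The weight subspace `V[ν]`. -/
def weightSubspace (ν : Dual ℂ H) : Submodule ℂ (⨂[ℂ] i, V i) :=
  ⨅ h : H, LinearMap.ker (totalAct V (h : L) - ν h • (1 : End ℂ (⨂[ℂ] i, V i)))

variable {H}

lemma mem_weightSubspace_iff (ν : Dual ℂ H) (w : ⨂[ℂ] i, V i) :
    w ∈ weightSubspace V H ν ↔ ∀ h : H, totalAct V (h : L) w = ν h • w := by
  simp [weightSubspace, sub_eq_zero]

lemma mapsTo_of_commute {ν : Dual ℂ H} {A : End ℂ (⨂[ℂ] i, V i)}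
    (hA : ∀ h : H, totalAct V (h : L) * A = A * totalAct V (h : L)) :
    ∀ w ∈ weightSubspace V H ν, A w ∈ weightSubspace V H ν := by
  intro w hw
  rw [mem_weightSubspace_iff] at hw ⊢
  intro h
  have := LinearMap.congr_fun (hA h) w
  simp only [Module.End.mul_apply] at this
  rw [this, hw h, map_smul]

lemma factorAct_cartan_commute (k : Fin n) (h' h : H) :
    totalAct V (h : L) * factorAct V k (h' : L) = factorAct V k (h' : L) * totalAct V (h : L) := by
  have h0 : ⁅(h : L), (h' : L)⁆ = 0 := by
    rw [← LieSubalgebra.coe_bracket, trivial_lie_zero]; rfl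
  have hz : factorAct V k (0 : L) = 0 := by simpa using factorAct_smul V k (0 : ℂ) (0 : L)
  rw [totalAct_factorAct, h0, hz, add_zero]

namespace RootData

variable (D : RootData H)

lemma lie_e (h : H) (α : H.root) : ⁅(h : L), D.e α⁆ = D.rt α h • D.e α := by
  have := IsKilling.lie_eq_smul_of_mem_rootSpace (D.e_mem α) h
  simpa [rt] using this

lemma rt_neg (α : H.root) : D.rt (D.neg α) = -D.rt α := by
  rw [rt, neg, RootPairing.root_reflectionPerm, RootPairing.reflection_apply_self]; rfl

/-- `½ ∑ x_i^{(k)} x_i^{(l)}`, the operator `(Ω^0)^{(k,l)}`. -/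
def omegaZero (k l : Fin n) : End ℂ (⨂[ℂ] i, V i) :=
  (1 / 2 : ℂ) • ∑ i, factorAct V k (D.x i : L) * factorAct V l (D.x i : L)

/-- `(Ω^+)^{(k,l)}`. -/
def omegaPlus (k l : Fin n) : End ℂ (⨂[ℂ] i, V i) :=
  D.omegaZero V k l + ∑ α ∈ D.posRoots, factorAct V k (D.e α) * factorAct V l (D.e (D.neg α))

/-- `(Ω^-)^{(k,l)}`. -/
def omegaMinus (k l : Fin n) : End ℂ (⨂[ℂ] i, V i) :=
  D.omegaZero V k l + ∑ α ∈ D.posRoots, factorAct V k (D.e (D.neg α)) * factorAct V l (D.e α)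

/-- The Casimir operator `Ω^{(k,l)}`. -/
def omega (k l : Fin n) : End ℂ (⨂[ℂ] i, V i) := D.omegaPlus V k l + D.omegaMinus V k l

/-- The trigonometric R-matrix `r(z)^{(k,l)} = (Ω^+ z + Ω^-)^{(k,l)} / (z - 1)`. -/
def rMatrix (k l : Fin n) (z : ℂ) : End ℂ (⨂[ℂ] i, V i) :=
  (z - 1)⁻¹ • (z • D.omegaPlus V k l + D.omegaMinus V k l)

lemma totalAct_pair_commute (k l : Fin n) (h : H) {y z : L} {c : ℂ}
    (hy : ⁅(h : L), y⁆ = c • y) (hz : ⁅(h : L), z⁆ = (-c) • z) :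
    totalAct V (h : L) * (factorAct V k y * factorAct V l z) =
      (factorAct V k y * factorAct V l z) * totalAct V (h : L) := by
  rw [← mul_assoc, totalAct_factorAct, hy, factorAct_smul, add_mul, mul_assoc,
    totalAct_factorAct, hz, factorAct_smul]
  simp only [mul_add, smul_mul_assoc, mul_smul_comm, mul_assoc]
  module

lemma omega_commute (k l : Fin n) (h : H) :
    totalAct V (h : L) * D.omega V k l = D.omega V k l * totalAct V (h : L) := by
  have hz : totalAct V (h : L) * D.omegaZero V k l = D.omegaZero V k l * totalAct V (h : L) := by
    rw [omegaZero, mul_smul_comm, smul_mul_assoc, Finset.mul_sum, Finset.sum_mul]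
    congr 1
    refine Finset.sum_congr rfl fun i _ => ?_
    rw [← mul_assoc, factorAct_cartan_commute, mul_assoc, factorAct_cartan_commute, mul_assoc]
  have h1 : ∀ α : H.root, ⁅(h : L), D.e (D.neg α)⁆ = (-(D.rt α h)) • D.e (D.neg α) := fun α => by
    rw [lie_e, rt_neg]; rfl
  rw [omega, omegaPlus, omegaMinus]
  simp only [mul_add, add_mul, hz, Finset.mul_sum, Finset.sum_mul]
  congr 2
  · exact Finset.sum_congr rfl fun α _ => totalAct_pair_commute V k l h (D.lie_e h α) (h1 α)
  · refine Finset.sum_congr rfl fun α _ => totalAct_pair_commute V k l h (h1 α) ?_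
    rw [neg_neg]; exact D.lie_e h α

/-! ### The operators of the dynamical equations -/

/-- `Δ^{(n)}(E_α)` with `E_α = 2/(α,α) e_α`. -/
def EOp (α : H.root) : End ℂ (⨂[ℂ] i, V i) :=
  totalAct V ((2 / D.dualForm (D.rt α) (D.rt α)) • D.e α)

/-- `Δ^{(n)}(F_α)` with `F_α = e_{-α}`. -/
def FOp (α : H.root) : End ℂ (⨂[ℂ] i, V i) := totalAct V (D.e (D.neg α))

/-- `(λ, α^∨)` for `λ ∈ H`, where `α^∨ = 2α/(α,α)`. -/
def pairCoroot (lam : H) (α : H.root) : ℂ := 2 * D.rt α lam / D.dualForm (D.rt α) (D.rt α)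

/-- The operator `𝔹_V^α(λ)` on the weight subspace `V[ν]`, that is
`p(t; H_α, E_α, F_α) = ∑_m F_α^m E_α^m (1/m!) ∏_{j<m} (t - H_α - j)⁻¹` with
`t = (λ + ν/2, α^∨) - 1`; on `V[ν]` the element `H_α` acts as the scalar `(ν, α^∨)`.
Almost all terms vanish since `E_α` acts nilpotently. -/
def BOp (ν : Dual ℂ H) (α : H.root) (lam : H) : End ℂ (⨂[ℂ] i, V i) :=
  ∑ᶠ m : ℕ, ((1 / (m.factorial : ℂ)) *
    ∏ j ∈ Finset.range m,
      ((D.pairCoroot lam α + ν (D.corootVec α) / 2 - 1) - ν (D.corootVec α) - j)⁻¹) •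
        (D.FOp V α ^ m * D.EOp V α ^ m)

end RootData

/-- The exponential of an endomorphism of a finite dimensional space, computed in a basis. -/
def expEnd {W : Type*} [AddCommGroup W] [Module ℂ W] [FiniteDimensional ℂ W] (A : End ℂ W) :
    End ℂ W :=
  Matrix.toLin (finBasis ℂ W) (finBasis ℂ W)
    (NormedSpace.exp (LinearMap.toMatrix (finBasis ℂ W) (finBasis ℂ W) A))

/-- `∏_k z_k^{ω^{(k)}}`, where `logz k` is the value of `log z_k`. -/
def zPow (logz : Fin n → ℂ) (ω : H) : End ℂ (⨂[ℂ] i, V i) :=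
  expEnd (∑ k, logz k • factorAct V k (ω : L))

namespace RootData

variable (D : RootData H)

/-- The operator `G̃_V^{[α,j]}(z, λ) = ∏ z_k^{ω^{(k)}} 𝔹_V^α(λ - κω) ∏ z_k^{-ω^{(k)}}` on `V[ν]`,
where `ω ∈ P^∨` and `(ω, α) = -j`. -/
def GOp (ν : Dual ℂ H) (κ : ℂ) (logz : Fin n → ℂ) (lam : H) (a : D.AffRoot) :
    End ℂ (⨂[ℂ] i, V i) :=
  zPow V logz (D.shift a.1 a.2) * D.BOp V ν a.1 (lam - κ • D.shift a.1 a.2) *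
    zPow V logz (-D.shift a.1 a.2)

/-- The operator `G̃^{α̃^l} ⋯ G̃^{α̃^1}` attached to a word `[j_1, …, j_l]`. -/
def GWord (ν : Dual ℂ H) (κ : ℂ) (logz : Fin n → ℂ) (lam : H)
    (js : List (Option D.base.support)) : End ℂ (⨂[ℂ] i, V i) :=
  ((D.wordRoots js).map (D.GOp V ν κ logz lam)).reverse.prod

/-! ### The function `D_{V[ν]}` -/

/-- The `sl_2`-submodule `V[ν]_α` generated by `V[ν]`, for the triple `H_α, E_α, F_α`. -/
def sl2Span (ν : Dual ℂ H) (α : H.root) : Submodule ℂ (⨂[ℂ] i, V i) :=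
  sInf {W | weightSubspace V H ν ≤ W ∧ (∀ w ∈ W, D.EOp V α w ∈ W) ∧ (∀ w ∈ W, D.FOp V α w ∈ W) ∧
    ∀ w ∈ W, totalAct V (D.corootVec α : L) w ∈ W}

/-- `d^α_k`: the multiplicity of `L_{ν+kα}` in `V[ν]_α`, i.e. the dimension of the space of highest
weight vectors of weight `ν + kα` in `V[ν]_α`. -/
def mult (ν : Dual ℂ H) (α : H.root) (k : ℕ) : ℕ :=
  finrank ℂ (D.sl2Span V ν α ⊓ LinearMap.ker (D.EOp V α) ⊓
    weightSubspace V H (ν + k • D.rt α) : Submodule ℂ (⨂[ℂ] i, V i))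

/-- `½ (ν + jα, α)`. -/
def halfShift (ν : Dual ℂ H) (α : H.root) (j : ℕ) : ℂ :=
  D.dualForm (ν + j • D.rt α) (D.rt α) / 2

/-- `X_{α,V[ν]}(λ)`; almost all factors are `1`. -/
def X (ν : Dual ℂ H) (κ : ℂ) (α : H.root) (lam : H) : ℂ :=
  ∏ᶠ k : ℕ, (∏ j ∈ Finset.Icc 1 k,
    Complex.Gamma (1 - (D.rt α lam - D.halfShift ν α j) / κ) /
      Complex.Gamma (1 - (D.rt α lam + D.halfShift ν α j) / κ)) ^ D.mult V ν α k

/-- `Λ_k(λ)`, the trace of `λ^{(k)}` on `V[ν]`. -/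
def Lam (_ : RootData H) (ν : Dual ℂ H) (k : Fin n) (lam : H) : ℂ :=
  LinearMap.trace ℂ (weightSubspace V H ν)
    ((factorAct V k (lam : L)).restrict
      (mapsTo_of_commute V fun h => factorAct_cartan_commute V k lam h))

/-- `ε_{k,l}`, the trace of `Ω^{(k,l)}` on `V[ν]`. -/
def eps (ν : Dual ℂ H) (k l : Fin n) : ℂ :=
  LinearMap.trace ℂ (weightSubspace V H ν)
    ((D.omega V k l).restrict (mapsTo_of_commute V fun h => D.omega_commute V k l h))

/-- `γ_k = ∑_{l ≠ k} ε_{k,l}`. -/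
def gam (ν : Dual ℂ H) (k : Fin n) : ℂ := ∑ l ∈ Finset.univ.filter (· ≠ k), D.eps V ν k l

/-- `D_{V[ν]}(z, λ)`, where `logz k` is the value of `log z_k` and `logd k l` that of
`log (z_k - z_l)`. -/
def detFun (ν : Dual ℂ H) (κ : ℂ) (logz : Fin n → ℂ) (logd : Fin n → Fin n → ℂ) (lam : H) : ℂ :=
  (∏ k, Complex.exp (logz k * (Lam V D ν k lam / κ - D.gam V ν k / (2 * κ)))) *
    (∏ k, ∏ l ∈ Finset.univ.filter (k < ·), Complex.exp (logd k l * (D.eps V ν k l / κ))) *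
    ∏ α ∈ D.posRoots, D.X V ν κ α lam

/-- `λ` is regular if no denominator of `𝔹_V^α` on `V[ν]`, `α ∈ Σ_+`, vanishes at a point of
`λ + κ P^∨`: one has `(λ - ½(ν + jα), α) ∉ κℤ` whenever `1 ≤ j ≤ k` and `d^α_k ≠ 0`. -/
def IsRegular (ν : Dual ℂ H) (κ : ℂ) (lam : H) : Prop :=
  ∀ α ∈ D.posRoots, ∀ k : ℕ, D.mult V ν α k ≠ 0 → ∀ j ∈ Finset.Icc 1 k, ∀ m : ℤ,
    D.rt α lam - D.halfShift ν α j ≠ m * κ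

end RootData

end Operators

/-! ### Solutions -/

/-- Let `p : Y → ℂ^n` be a local homeomorphism. The function `f` on `Y`, with values in a finite
dimensional space, has partial derivative `w` at `y` in the `k`-th of the local coordinates `p`. -/
def HasPartialDerivAt {Y W : Type*} [TopologicalSpace Y] [AddCommGroup W] [Module ℂ W] {n : ℕ}
    (p : Y → Fin n → ℂ) (k : Fin n) (f : Y → W) (w : W) (y : Y) : Prop :=
  ∃ s : OpenPartialHomeomorph Y (Fin n → ℂ), y ∈ s.source ∧ ⇑s = p ∧
    ∀ φ : Dual ℂ W,
      HasDerivAt (fun t : ℂ => φ (f (s.symm (Function.update (p y) k t)))) (φ w) (p y k)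

section Solutions

variable {n : ℕ} (V : Fin n → Type*) [∀ k, AddCommGroup (V k)] [∀ k, Module ℂ (V k)]
  [∀ k, LieRingModule L (V k)] [∀ k, LieModule ℂ L (V k)] [∀ k, FiniteDimensional ℂ (V k)]
  {H : LieSubalgebra ℂ L} [H.IsCartanSubalgebra] (D : RootData H)
  {Y : Type*} [TopologicalSpace Y]

/-- The function `u(z, λ)` with values in `V[ν]`, for `z` on `Y` and `λ ∈ S`, satisfies the
trigonometric KZ equations
`κ z_k ∂u/∂z_k = ∑_{l ≠ k} r(z_k/z_l)^{(k,l)} u + λ^{(k)} u`, `k = 1, …, n`. -/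
def SolvesKZ (ν : Dual ℂ H) (κ : ℂ) (p : Y → Fin n → ℂ) (S : Set H)
    (u : Y → H → weightSubspace V H ν) : Prop :=
  ∀ lam ∈ S, ∀ (y : Y) (k : Fin n), ∃ w : weightSubspace V H ν,
    HasPartialDerivAt p k (fun y' => u y' lam) w y ∧
    (κ * p y k) • (w : ⨂[ℂ] i, V i) =
      (∑ l ∈ Finset.univ.filter (· ≠ k), D.rMatrix V k l (p y k / p y l)) (u y lam) +
        factorAct V k (lam : L) (u y lam)

/-- The function `u(z, λ)` with values in `V[ν]` satisfies the dynamical difference equations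
`∏ z_k^{-(ω_i^∨)^{(k)}} u(z, λ + κ ω_i^∨) = G̃_{t_{ω_i^∨}}(z, λ) u(z, λ)`, where `G̃_{t_{ω_i^∨}}` is
computed with the word `word i`. -/
def SolvesDynamical (ν : Dual ℂ H) (κ : ℂ) (logz : Y → Fin n → ℂ)
    (word : D.base.support → List (Option D.base.support)) (S : Set H)
    (u : Y → H → weightSubspace V H ν) : Prop :=
  ∀ lam ∈ S, ∀ (y : Y) (i : D.base.support),
    zPow V (logz y) (-D.fundCoweight i) (u y (lam + κ • D.fundCoweight i) : ⨂[ℂ] i, V i) =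
      D.GWord V ν κ (logz y) lam (word i) (u y lam)

end Solutions

end KZDyn

end

/-!
The determinant of the solutions and the function `D_{V[ν]}` satisfy the same scalar equations.

*In `z`.* By Jacobi's formula the determinant has logarithmic derivative the trace over `V[ν]` of
the KZ operator. A product `e_α^{(k)} e_{-α}^{(l)}` is a multiple of its own commutator with an
element of `𝔥^{(k)}`, so it has trace zero (`trace_pair`); hence `Ω^+` and `Ω^-` both have trace
`ε_{k,l} / 2`, and the trace of the KZ operator is the logarithmic derivative of the `z`-dependent
part of `D_{V[ν]}` (`hasDerivAt_zExponent`). The quotient is locally constant, so constant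
(`exists_det_eq`).

*In `λ`.* The determinant on `V[ν]` of the operator of the `i`-th dynamical equation is needed.

* Put `K_k = ker E_α^k` in `V[ν]`. On `K_{k+1} / K_k` each `F_α^m E_α^m` is an explicit scalar
  (`IsTriple.pow_e_pow_fe`), so `det 𝔹_V^α` is a product of scalars, each of which is summed by the
  Chu-Vandermonde identity (`sum_feValue`). The exponents `dim K_{k+1} - dim K_k` are the
  multiplicities `d^α_k`, because the weight `ν + kα` part of the `sl_2`-module generated by `V[ν]`
  is just `E_α^k V[ν]` (`IsTriple.mem_map_pow_e`); complete reducibility plays no role. The result is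
  `det 𝔹_V^α(λ) = ∏_k (∏_{j ≤ k} (s + h_j) / (s - h_j))^{d^α_k}` with `s = (λ, α)` and
  `h_j = ½ (ν + jα, α)` (`det_res_BOp`).
* The affine roots of a reduced word are the positive affine roots which it makes negative, each
  occurring once (`IsShortest.nodup`, `IsShortest.mem_wordRoots`). Since `π` permutes the simple
  affine roots it preserves heights, so for a reduced presentation of `t_{ω_i^∨}` these roots are
  the `[α, j]` with `α` positive and `0 ≤ j < (ω_i^∨, α)`
  (`IsReducedPresentation.mem_wordRoots`).
* The equation `Γ(x + 1) = x Γ(x)` shows that `∏_α X_α` is multiplied by the same factor under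
  `λ ↦ λ + κ ω_i^∨` (`prod_X_shift`).

So the determinant and `D_{V[ν]}` acquire common factors under the translations by `κ ω_i^∨`
(`exists_common_factor`). As `1 / Γ` has zeros, `D_{V[ν]}` may vanish; but it is non-zero far away
in the antidominant direction, and there the quotient can be formed. Any two points of an orbit are
reached by dominant translations from a common point, so the quotient does not depend on the
choice (`exists_periodic_quotient`).
-/

set_option linter.unusedSectionVars false

noncomputable section

namespace KZDyn

/-! ### Determinants of exponentials, of matrix functions and of filtered endomorphisms -/

section LinearAlgebra

variable {ι : Type*} [Fintype ι] [DecidableEq ι]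

/-- Jacobi's formula for the derivative of a determinant. -/
lemma hasDerivAt_det {M : ℂ → Matrix ι ι ℂ} {M' : Matrix ι ι ℂ} {t : ℂ}
    (h : ∀ i j, HasDerivAt (fun s => M s i j) (M' i j) t) :
    HasDerivAt (fun s => (M s).det) ((M t).adjugate * M').trace t := by
  have h1 : HasDerivAt (fun s => (M s).det)
      (∑ σ : Equiv.Perm ι, (Equiv.Perm.sign σ : ℂ) *
        ∑ i, (∏ j ∈ Finset.univ.erase i, M t (σ j) j) * M' (σ i) i) t := by
    simp only [Matrix.det_apply']
    refine HasDerivAt.fun_sum fun σ _ => HasDerivAt.const_mul _ ?_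
    simpa only [smul_eq_mul] using HasDerivAt.fun_finsetProd fun i _ => h (σ i) i
  convert h1 using 1
  simp only [Matrix.trace, Matrix.diag_apply, Finset.mul_sum]
  rw [Finset.sum_comm]
  refine Finset.sum_congr rfl fun i _ => ?_
  have h2 : ((M t).adjugate * M') i i = (M t).cramer (fun j => M' j i) i := by
    rw [Matrix.cramer_eq_adjugate_mulVec]; rfl
  rw [h2, Matrix.cramer_apply, Matrix.det_apply']
  refine Finset.sum_congr rfl fun σ _ => ?_
  rw [← Finset.prod_erase_mul _ _ (Finset.mem_univ i)]
  congr 2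
  · exact Finset.prod_congr rfl fun j hj => by
      rw [Matrix.updateCol_ne (Finset.ne_of_mem_erase hj)]
  · rw [Matrix.updateCol_self]

attribute [local instance] Matrix.linftyOpNormedRing Matrix.linftyOpNormedAlgebra in
lemma hasDerivAt_matrix_exp (A : Matrix ι ι ℂ) (t : ℂ) (i j : ι) :
    HasDerivAt (fun s : ℂ => NormedSpace.exp (s • A) i j)
      ((A * NormedSpace.exp (t • A)) i j) t := by
  have h := hasDerivAt_exp_smul_const' (𝕂 := ℂ) A t
  let φ : Matrix ι ι ℂ →ₗ[ℂ] ℂ := Matrix.entryLinearMap ℂ ℂ i j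
  exact (LinearMap.toContinuousLinearMap φ).hasFDerivAt.comp_hasDerivAt t h

lemma det_matrix_exp (A : Matrix ι ι ℂ) :
    (NormedSpace.exp A).det = Complex.exp A.trace := by
  have key : ∀ t : ℂ, HasDerivAt
      (fun s : ℂ => (NormedSpace.exp (s • A)).det * Complex.exp (-(s * A.trace))) 0 t := by
    intro t
    have h1 := hasDerivAt_det (M := fun s : ℂ => NormedSpace.exp (s • A))
      (M' := A * NormedSpace.exp (t • A)) (t := t) (hasDerivAt_matrix_exp A t)
    have h2 : HasDerivAt (fun s : ℂ => Complex.exp (-(s * A.trace)))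
        (Complex.exp (-(t * A.trace)) * (-(1 * A.trace))) t :=
      (((hasDerivAt_id t).mul_const A.trace).neg).cexp
    refine (h1.mul h2).congr_deriv ?_
    rw [Matrix.trace_mul_comm, Matrix.mul_assoc, Matrix.mul_adjugate, Matrix.mul_smul,
      Matrix.mul_one, Matrix.trace_smul, smul_eq_mul]
    ring
  have h := is_const_of_deriv_eq_zero (fun t => (key t).differentiableAt)
    (fun t => (key t).deriv) 1 0
  simp only [one_smul, zero_smul, NormedSpace.exp_zero, Matrix.det_one, one_mul, zero_mul, neg_zero,
    Complex.exp_zero] at h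
  rw [← mul_right_inj' (Complex.exp_ne_zero (-A.trace)), mul_comm, h, ← Complex.exp_add]
  simp

section ExpEnd

variable {W U : Type*} [AddCommGroup W] [Module ℂ W] [FiniteDimensional ℂ W]
  [AddCommGroup U] [Module ℂ U] [FiniteDimensional ℂ U]

attribute [local instance] Matrix.linftyOpNormedRing Matrix.linftyOpNormedAlgebra in
/-- Exponentials of intertwined matrices are intertwined. -/
lemma matrix_exp_intertwine {m : Type*} [Fintype m] [DecidableEq m]
    {A : Matrix ι ι ℂ} {B : Matrix m m ℂ} {P : Matrix ι m ℂ} (h : A * P = P * B) :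
    NormedSpace.exp A * P = P * NormedSpace.exp B := by
  have hpow : ∀ k : ℕ, A ^ k * P = P * B ^ k := by
    intro k
    induction k with
    | zero => simp
    | succ k ih => rw [pow_succ', Matrix.mul_assoc, ih, ← Matrix.mul_assoc, h, Matrix.mul_assoc,
        ← pow_succ']
  have hA := (NormedSpace.exp_series_hasSum_exp' (𝕂 := ℂ) A)
  have hB := (NormedSpace.exp_series_hasSum_exp' (𝕂 := ℂ) B)
  have hA' := hA.map (AddMonoidHom.mk' (fun M : Matrix ι ι ℂ => M * P) fun _ _ => Matrix.add_mul _ _ _)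
    (Continuous.matrix_mul continuous_id continuous_const)
  have hB' := hB.map (AddMonoidHom.mk' (fun M : Matrix m m ℂ => P * M) fun _ _ => Matrix.mul_add _ _ _)
    (Continuous.matrix_mul continuous_const continuous_id)
  refine hA'.unique ?_
  convert hB' using 1
  · funext k
    simp [hpow]
  · rfl

lemma expEnd_intertwine {A : End ℂ W} {B : End ℂ U} {f : U →ₗ[ℂ] W} (h : A ∘ₗ f = f ∘ₗ B) :
    expEnd A ∘ₗ f = f ∘ₗ expEnd B := by
  apply (LinearMap.toMatrix (finBasis ℂ U) (finBasis ℂ W)).injective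
  rw [LinearMap.toMatrix_comp _ (finBasis ℂ W), LinearMap.toMatrix_comp _ (finBasis ℂ U), expEnd,
    expEnd, LinearMap.toMatrix_toLin, LinearMap.toMatrix_toLin]
  apply matrix_exp_intertwine
  rw [← LinearMap.toMatrix_comp, ← LinearMap.toMatrix_comp, h]

lemma det_expEnd (A : End ℂ W) : LinearMap.det (expEnd A) = Complex.exp (LinearMap.trace ℂ W A) := by
  rw [expEnd, LinearMap.det_toLin, det_matrix_exp, LinearMap.trace_eq_matrix_trace ℂ (finBasis ℂ W)]

end ExpEnd

/-- If `f` acts on the successive quotients of a filtration by scalars, its determinant is the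
product of these scalars. -/
lemma det_eq_prod_of_filtration {W : Type*} [AddCommGroup W] [Module ℂ W] [FiniteDimensional ℂ W]
    (f : End ℂ W) (K : ℕ → Submodule ℂ W) (hK : Monotone K) (hK0 : K 0 = ⊥) (b : ℕ → ℂ)
    (N : ℕ) (hf : ∀ k < N, ∀ w ∈ K (k + 1), f w - b k • w ∈ K k) (hN : K N = ⊤) :
    LinearMap.det f =
      ∏ k ∈ Finset.range N, b k ^ (finrank ℂ (K (k + 1)) - finrank ℂ (K k)) := by
  induction N generalizing W with
  | zero =>
    have : Subsingleton W := by
      rw [← Submodule.subsingleton_iff ℂ, ← subsingleton_iff_bot_eq_top, ← hK0, hN]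
    rw [Subsingleton.elim f LinearMap.id, LinearMap.det_id, Finset.prod_range_zero]
  | succ N ih =>
    have hmaps : ∀ k ≤ N, ∀ w ∈ K k, f w ∈ K k := by
      intro k hk w hw
      have h1 := hf k (by omega) w (hK k.le_succ hw)
      simpa using add_mem h1 (Submodule.smul_mem _ (b k) hw)
    have hle : K N ≤ (K N).comap f := hmaps N le_rfl
    rw [LinearMap.det_eq_det_mul_det (K N) f hle, Finset.prod_range_succ]
    congr 1
    · have hfr : ∀ k ≤ N, finrank ℂ ((K k).comap (K N).subtype) = finrank ℂ (K k) := fun k hk =>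
        (Submodule.comapSubtypeEquivOfLe (hK hk)).finrank_eq
      rw [ih (f.restrict hle) (fun k => (K k).comap (K N).subtype)
        (fun i j hij => Submodule.comap_mono (hK hij)) (by simp [hK0])
        (fun k hk w hw => hf k (by omega) w hw) (by simp)]
      refine Finset.prod_congr rfl fun k hk => ?_
      rw [Finset.mem_range] at hk
      rw [hfr _ hk, hfr _ hk.le]
    · have : (K N).mapQ (K N) f hle = b N • LinearMap.id := by
        ext w
        simp only [LinearMap.comp_apply, Submodule.mkQ_apply, Submodule.mapQ_apply,
          LinearMap.smul_apply, LinearMap.id_apply]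
        rw [← Submodule.Quotient.mk_smul, Submodule.Quotient.eq]
        exact hf N (by omega) w (by rw [hN]; trivial)
      rw [this, LinearMap.det_smul, LinearMap.det_id, mul_one, hN, finrank_top,
        Submodule.finrank_quotient]

end LinearAlgebra

/-! ### Operators `∑ a_m F^m E^m` on a weight space of an `sl_2`-triple -/

section Sl2

variable {T : Type*} [AddCommGroup T] [Module ℂ T] {E F K : End ℂ T}

/-- The eigenvalue of `F E` on the vector of weight `h` in the irreducible `sl_2`-module of highest
weight `h + 2k`. -/
def feValue (h : ℂ) (k : ℕ) : ℂ := k * (h + 1 + k)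

/-- The commutation relations of an `sl_2`-triple of operators. -/
structure IsTriple (E F K : End ℂ T) : Prop where
  ef : ∀ x, E (F x) = F (E x) + K x
  ke : ∀ x, K (E x) = E (K x) + (2 : ℂ) • E x
  kf : ∀ x, K (F x) = F (K x) - (2 : ℂ) • F x

namespace IsTriple

variable (hT : IsTriple E F K)
include hT

lemma weight_pow_e {x : T} {c : ℂ} (hx : K x = c • x) (k : ℕ) :
    K ((E ^ k) x) = (c + 2 * k) • (E ^ k) x := by
  induction k with
  | zero => simpa using hx
  | succ k ih =>
    rw [pow_succ', Module.End.mul_apply, hT.ke, ih, map_smul]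
    push_cast
    module

lemma weight_pow_f {x : T} {c : ℂ} (hx : K x = c • x) (k : ℕ) :
    K ((F ^ k) x) = (c - 2 * k) • (F ^ k) x := by
  induction k with
  | zero => simpa using hx
  | succ k ih =>
    rw [pow_succ', Module.End.mul_apply, hT.kf, ih, map_smul]
    push_cast
    module

lemma pow_e_f {x : T} {c : ℂ} (hx : K x = c • x) (k : ℕ) :
    (E ^ (k + 1)) (F x) = F ((E ^ (k + 1)) x) + ((k + 1) * (c + k)) • (E ^ k) x := by
  induction k with
  | zero => simp [hT.ef, hx]
  | succ k ih =>
    rw [pow_succ', Module.End.mul_apply, ih, map_add, hT.ef, hT.weight_pow_e hx, map_smul,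
      ← Module.End.mul_apply E, ← pow_succ', ← Module.End.mul_apply E (E ^ k), ← pow_succ']
    push_cast
    module

/-- On the kernel of `E^{k+1}` in weight `h`, the operator `F E` acts as `feValue h k` modulo the
kernel of `E^k`. -/
lemma pow_e_fe {v : T} {h : ℂ} (hv : K v = h • v) (k : ℕ) :
    (E ^ k) (F (E v)) = F ((E ^ (k + 1)) v) + feValue h k • (E ^ k) v := by
  cases k with
  | zero => simp [feValue]
  | succ k =>
    have hx : K (E v) = (h + 2) • E v := by simpa using hT.weight_pow_e hv 1
    rw [hT.pow_e_f hx, ← Module.End.mul_apply _ E, ← pow_succ, ← Module.End.mul_apply _ E,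
      ← pow_succ, feValue]
    push_cast
    congr 2
    ring

lemma e_pow_f {v : T} {h : ℂ} (hv : K v = h • v) (k : ℕ) :
    ∃ c : ℂ, E ((F ^ (k + 1)) v) = (F ^ k) (F (E v)) + c • (F ^ k) v := by
  induction k with
  | zero => exact ⟨h, by simp [hT.ef, hv]⟩
  | succ k ih =>
    obtain ⟨c, hc⟩ := ih
    refine ⟨c + (h - 2 * (k + 1 : ℕ)), ?_⟩
    rw [pow_succ', Module.End.mul_apply, hT.ef, hc, hT.weight_pow_f hv, map_add, map_smul,
      ← Module.End.mul_apply F (F ^ k), ← Module.End.mul_apply F (F ^ k), ← pow_succ']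
    module

variable {W : Submodule ℂ T} {h : ℂ} (hW : ∀ w ∈ W, K w = h • w) (hFE : ∀ w ∈ W, F (E w) ∈ W)
include hW hFE

lemma pow_fe_mem {v : T} (hv : v ∈ W) (m : ℕ) : (F ^ m) ((E ^ m) v) ∈ W := by
  induction m generalizing v with
  | zero => simpa
  | succ m ih =>
    have h1 := hT.pow_e_fe (hW v hv) m
    rw [← sub_eq_iff_eq_add] at h1
    rw [pow_succ F, Module.End.mul_apply, ← h1, map_sub, map_smul]
    exact sub_mem (ih (hFE v hv)) (W.smul_mem _ (ih hv))

/-- On `ker E^{k+1}`, modulo `ker E^k`, the operator `F^m E^m` is a scalar. -/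
lemma pow_e_pow_fe {v : T} (hv : v ∈ W) {k : ℕ} (hk : (E ^ (k + 1)) v = 0) (m : ℕ) :
    (E ^ k) ((F ^ m) ((E ^ m) v)) =
      (∏ i ∈ Finset.range m, (feValue h k - feValue h i)) • (E ^ k) v := by
  induction m generalizing v with
  | zero => simp
  | succ m ih =>
    -- `F^{m+1} E^{m+1} = F^m E^m (F E - c_m)` on `W`, where `c_m = feValue h m`
    have h1 := hT.pow_e_fe (hW v hv) m
    rw [← sub_eq_iff_eq_add, ← map_smul, ← map_sub] at h1
    have h2 : (E ^ (k + 1)) (F (E v) - feValue h m • v) = 0 := by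
      rw [map_sub, hT.pow_e_fe (hW v hv), map_smul, hk, pow_succ', Module.End.mul_apply, hk]
      simp
    rw [pow_succ F, Module.End.mul_apply, ← h1,
      ih (sub_mem (hFE v hv) (W.smul_mem _ hv)) h2, map_sub, hT.pow_e_fe (hW v hv), hk, map_smul,
      map_zero, zero_add, ← sub_smul, smul_smul, Finset.prod_range_succ]

omit hT hW hFE in
/-- The kernel of `E^k` in `W`. -/
def kerPow (E : End ℂ T) (W : Submodule ℂ T) (k : ℕ) : Submodule ℂ W :=
  LinearMap.ker ((E ^ k) ∘ₗ W.subtype)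

/-- The determinant of `∑ a_m F^m E^m` on a weight space. -/
lemma det_eq [FiniteDimensional ℂ T] {N : ℕ} (hN : E ^ N = 0) (a : ℕ → ℂ) (M : ℕ) (B : End ℂ W)
    (hB : ∀ w : W, (B w : T) = ∑ m ∈ Finset.range M, a m • (F ^ m) ((E ^ m) (w : T))) :
    LinearMap.det B = ∏ k ∈ Finset.range N,
      (∑ m ∈ Finset.range M,
        a m * ∏ i ∈ Finset.range m, (feValue h k - feValue h i)) ^
          (finrank ℂ (kerPow E W (k + 1)) - finrank ℂ (kerPow E W k)) := by
  refine det_eq_prod_of_filtration B (kerPow E W) ?_ ?_ _ N ?_ ?_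
  · refine monotone_nat_of_le_succ fun k w hw => ?_
    rw [kerPow, LinearMap.mem_ker, LinearMap.comp_apply] at hw ⊢
    rw [pow_succ', Module.End.mul_apply, hw, map_zero]
  · rw [kerPow, LinearMap.ker_eq_bot]
    exact W.injective_subtype
  · intro k _ w hw
    rw [kerPow, LinearMap.mem_ker, LinearMap.comp_apply] at hw ⊢
    rw [map_sub, map_sub, map_smul, map_smul, Submodule.subtype_apply, hB, map_sum, Finset.sum_smul,
      sub_eq_zero]
    refine Finset.sum_congr rfl fun m _ => ?_
    rw [map_smul, hT.pow_e_pow_fe hW hFE w.2 hw, smul_smul, Submodule.subtype_apply]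
  · rw [kerPow, hN, LinearMap.zero_comp, LinearMap.ker_zero]

omit hT hW hFE in
/-- The piece of weight `h + 2j` of the submodule generated by `W` under `E` and `F`, where `W` has
weight `h`: it is `E^j W` for `j ≥ 0` and `F^{-j} W` for `j < 0`. -/
def genPiece (E F : End ℂ T) (W : Submodule ℂ T) (j : ℤ) : Submodule ℂ T :=
  if 0 ≤ j then W.map (E ^ j.toNat) else W.map (F ^ (-j).toNat)

omit hT hW hFE in
lemma genPiece_nat (k : ℕ) : genPiece E F W k = W.map (E ^ k) := by simp [genPiece]

omit hT hW hFE in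
lemma genPiece_neg (k : ℕ) : genPiece E F W (-(k + 1 : ℕ)) = W.map (F ^ (k + 1)) := by
  rw [genPiece, if_neg (by omega)]
  congr 2

omit hFE in
lemma genPiece_weight {j : ℤ} {x : T} (hx : x ∈ genPiece E F W j) : K x = (h + 2 * j) • x := by
  obtain ⟨k, rfl | rfl⟩ : ∃ k : ℕ, j = k ∨ j = -(k + 1 : ℕ) :=
    ⟨if 0 ≤ j then j.toNat else (-j).toNat - 1, by split_ifs <;> omega⟩
  · rw [genPiece_nat] at hx
    obtain ⟨w, hw, rfl⟩ := hx
    simpa using hT.weight_pow_e (hW w hw) k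
  · rw [genPiece_neg] at hx
    obtain ⟨w, hw, rfl⟩ := hx
    rw [hT.weight_pow_f (hW w hw)]
    push_cast
    congr 1
    ring

lemma e_mem_genPiece {j : ℤ} {x : T} (hx : x ∈ genPiece E F W j) :
    E x ∈ genPiece E F W (j + 1) := by
  obtain ⟨k, rfl | rfl⟩ : ∃ k : ℕ, j = k ∨ j = -(k + 1 : ℕ) :=
    ⟨if 0 ≤ j then j.toNat else (-j).toNat - 1, by split_ifs <;> omega⟩
  · rw [genPiece_nat] at hx
    obtain ⟨w, hw, rfl⟩ := hx
    rw [← Nat.cast_succ, genPiece_nat]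
    exact ⟨w, hw, by rw [pow_succ', Module.End.mul_apply]⟩
  · rw [genPiece_neg] at hx
    obtain ⟨w, hw, rfl⟩ := hx
    obtain ⟨c, hc⟩ := hT.e_pow_f (hW w hw) k
    rw [hc, ← map_smul, ← map_add]
    have hm := W.add_mem (hFE w hw) (W.smul_mem c hw)
    cases k with
    | zero => exact (genPiece_nat (E := E) (F := F) (W := W) 0).symm ▸ ⟨_, hm, by simp⟩
    | succ k =>
      have : -((k + 1 + 1 : ℕ) : ℤ) + 1 = -(k + 1 : ℕ) := by push_cast; ring
      rw [this, genPiece_neg]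
      exact ⟨_, hm, rfl⟩

lemma f_mem_genPiece {j : ℤ} {x : T} (hx : x ∈ genPiece E F W j) :
    F x ∈ genPiece E F W (j - 1) := by
  obtain ⟨k, rfl | rfl⟩ : ∃ k : ℕ, j = k ∨ j = -(k + 1 : ℕ) :=
    ⟨if 0 ≤ j then j.toNat else (-j).toNat - 1, by split_ifs <;> omega⟩
  · rw [genPiece_nat] at hx
    obtain ⟨w, hw, rfl⟩ := hx
    cases k with
    | zero =>
      have : ((0 : ℕ) : ℤ) - 1 = -((0 + 1 : ℕ) : ℤ) := by simp
      rw [this, genPiece_neg]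
      exact ⟨w, hw, by simp⟩
    | succ k =>
      have : ((k + 1 : ℕ) : ℤ) - 1 = (k : ℕ) := by push_cast; ring
      rw [this, genPiece_nat]
      have h1 := hT.pow_e_fe (hW w hw) k
      rw [← sub_eq_iff_eq_add, ← map_smul, ← map_sub] at h1
      exact ⟨_, W.sub_mem (hFE w hw) (W.smul_mem _ hw), h1⟩
  · rw [genPiece_neg] at hx
    obtain ⟨w, hw, rfl⟩ := hx
    have : -((k + 1 : ℕ) : ℤ) - 1 = -(k + 1 + 1 : ℕ) := by push_cast; ring
    rw [this, genPiece_neg]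
    exact ⟨w, hw, by rw [pow_succ' F (k + 1), Module.End.mul_apply]⟩

/-- The vectors of weight `h + 2k` in the `sl_2`-submodule generated by `W` form `E^k W`. -/
lemma mem_map_pow_e {U : Submodule ℂ T} (hU : ∀ U' : Submodule ℂ T, W ≤ U' →
    (∀ w ∈ U', E w ∈ U') → (∀ w ∈ U', F w ∈ U') → (∀ w ∈ U', K w ∈ U') → U ≤ U')
    {x : T} (hx : x ∈ U) {k : ℕ} (hk : K x = (h + 2 * k) • x) : x ∈ W.map (E ^ k) := by
  have hstab : ∀ (A : End ℂ T), (∀ j, ∀ y ∈ genPiece E F W j, ∃ i, A y ∈ genPiece E F W i) →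
      ∀ w ∈ ⨆ j, genPiece E F W j, A w ∈ ⨆ j, genPiece E F W j := by
    intro A hA
    have : ⨆ j, genPiece E F W j ≤ (⨆ j, genPiece E F W j).comap A := by
      refine iSup_le fun j y hy => ?_
      obtain ⟨i, hi⟩ := hA j y hy
      exact Submodule.mem_iSup_of_mem i hi
    exact this
  have hx' : x ∈ ⨆ j, genPiece E F W j := by
    refine hU _ ?_ (hstab E fun j y hy => ⟨_, hT.e_mem_genPiece hW hFE hy⟩)
      (hstab F fun j y hy => ⟨_, hT.f_mem_genPiece hW hFE hy⟩)
      (hstab K fun j y hy => ⟨j, ?_⟩) hx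
    · refine le_trans (le_of_eq ?_) (le_iSup _ (0 : ℤ))
      simpa [Module.End.one_eq_id] using (genPiece_nat (E := E) (F := F) (W := W) 0).symm
    · rw [hT.genPiece_weight hW hy]
      exact Submodule.smul_mem _ _ hy
  rw [← genPiece_nat (F := F)]
  have hind : iSupIndep fun j : ℤ => K.eigenspace (h + 2 * j) := by
    refine (Module.End.eigenspaces_iSupIndep K).comp (f := fun j : ℤ => h + 2 * (j : ℂ)) ?_
    intro i j hij
    simpa using hij
  rw [iSup_split_single _ (k : ℤ), Submodule.mem_sup] at hx'
  obtain ⟨a, ha, b, hb, rfl⟩ := hx'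
  have hwt : ∀ j, genPiece E F W j ≤ K.eigenspace (h + 2 * j) := fun j y hy => by
    rw [Module.End.mem_eigenspace_iff]
    exact hT.genPiece_weight hW hy
  have hb0 : b = 0 := by
    refine (Submodule.disjoint_def.1 (hind (k : ℤ))) b ?_ ?_
    · have h1 := hT.genPiece_weight hW ha
      rw [map_add, h1, smul_add] at hk
      rw [Module.End.mem_eigenspace_iff]
      simpa using hk
    · exact iSup_mono (fun j => iSup_mono fun _ => hwt j) hb
  rwa [hb0, add_zero]

/-- The number of highest weight vectors of weight `h + 2k` in the `sl_2`-submodule generated by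
`W`, in terms of the kernels of the powers of `E` in `W`. -/
lemma finrank_highest [FiniteDimensional ℂ T] {U : Submodule ℂ T} (hWU : W ≤ U)
    (hEU : ∀ w ∈ U, E w ∈ U)
    (hU : ∀ U' : Submodule ℂ T, W ≤ U' →
      (∀ w ∈ U', E w ∈ U') → (∀ w ∈ U', F w ∈ U') → (∀ w ∈ U', K w ∈ U') → U ≤ U')
    (k : ℕ) {Q : Submodule ℂ T} (hQ : ∀ x ∈ Q, K x = (h + 2 * k) • x)
    (hQ' : ∀ w ∈ W, (E ^ k) w ∈ Q) :
    finrank ℂ (U ⊓ LinearMap.ker E ⊓ Q : Submodule ℂ T) =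
      finrank ℂ (kerPow E W (k + 1)) - finrank ℂ (kerPow E W k) := by
  let g : kerPow E W (k + 1) →ₗ[ℂ] T := (E ^ k) ∘ₗ W.subtype ∘ₗ (kerPow E W (k + 1)).subtype
  have hle : kerPow E W k ≤ kerPow E W (k + 1) := fun w hw => by
    rw [kerPow, LinearMap.mem_ker, LinearMap.comp_apply] at hw ⊢
    rw [pow_succ', Module.End.mul_apply, hw, map_zero]
  have hpow : ∀ w ∈ W, ∀ j : ℕ, (E ^ j) w ∈ U := by
    intro w hw j
    induction j with
    | zero => simpa using hWU hw
    | succ j ih => rw [pow_succ', Module.End.mul_apply]; exact hEU _ ih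
  have hrange : LinearMap.range g = U ⊓ LinearMap.ker E ⊓ Q := by
    ext x
    constructor
    · rintro ⟨⟨w, hw⟩, rfl⟩
      refine ⟨⟨hpow w w.2 k, ?_⟩, hQ' w w.2⟩
      rw [kerPow, LinearMap.mem_ker, LinearMap.comp_apply, pow_succ', Module.End.mul_apply] at hw
      exact hw
    · rintro ⟨⟨hxU, hxE⟩, hxQ⟩
      obtain ⟨w, hw, rfl⟩ := hT.mem_map_pow_e hW hFE hU hxU (hQ x hxQ)
      refine ⟨⟨⟨w, hw⟩, ?_⟩, rfl⟩
      rw [kerPow, LinearMap.mem_ker, LinearMap.comp_apply, pow_succ', Module.End.mul_apply]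
      exact hxE
  have hker : LinearMap.ker g = (kerPow E W k).comap (kerPow E W (k + 1)).subtype := by
    ext w
    rfl
  have h1 := LinearMap.finrank_range_add_finrank_ker g
  rw [hrange, hker, (Submodule.comapSubtypeEquivOfLe hle).finrank_eq] at h1
  omega

end IsTriple

/-- An eigenvector of `ad K` with non-zero eigenvalue is nilpotent. -/
lemma IsTriple.exists_pow_e_eq_zero [FiniteDimensional ℂ T] (hT : IsTriple E F K) :
    ∃ N : ℕ, E ^ N = 0 := by
  by_contra! hne
  let ad : End ℂ (End ℂ T) := LinearMap.mulLeft ℂ K - LinearMap.mulRight ℂ K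
  have hpow : ∀ k : ℕ, ad.HasEigenvector (2 * k) (E ^ k) := by
    refine fun k => ⟨?_, hne k⟩
    rw [Module.End.mem_eigenspace_iff]
    induction k with
    | zero => simp [ad]
    | succ k ih =>
      simp only [ad, LinearMap.sub_apply, LinearMap.mulLeft_apply, LinearMap.mulRight_apply]
        at ih ⊢
      have h1 : K * E = E * K + (2 : ℂ) • E := LinearMap.ext hT.ke
      rw [pow_succ', ← mul_assoc, h1, add_mul, mul_assoc, mul_assoc, eq_add_of_sub_eq ih,
        smul_mul_assoc, mul_add, mul_smul_comm]
      push_cast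
      module
  have hli := Module.End.eigenvectors_linearIndependent' ad (fun k : ℕ => 2 * (k : ℂ))
    (fun i j hij => by simpa using hij) (fun k => E ^ k) hpow
  exact not_finite_iff_infinite.2 inferInstance hli.finite

/-- The rising factorial `x (x + 1) ⋯ (x + m - 1)`. -/
def rising (x : ℂ) (m : ℕ) : ℂ := ∏ i ∈ Finset.range m, (x + i)

lemma rising_succ_left (x : ℂ) (m : ℕ) : rising x (m + 1) = x * rising (x + 1) m := by
  rw [rising, Finset.prod_range_succ', mul_comm, rising]
  congr 1
  · simp
  · exact Finset.prod_congr rfl fun i _ => by push_cast; ring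

/-- The Chu-Vandermonde identity. -/
lemma sum_choose_rising (k : ℕ) (x y : ℂ) :
    ∑ m ∈ Finset.range (k + 1), (k.choose m : ℂ) * (rising x m * rising y (k - m)) =
      rising (x + y) k := by
  induction k generalizing x y with
  | zero => simp [rising]
  | succ k ih =>
    have h1 := Finset.sum_antidiagonal_choose_succ_mul (R := ℂ)
      (fun i j => rising x i * rising y j) k
    rw [Finset.Nat.sum_antidiagonal_eq_sum_range_succ_mk] at h1
    rw [h1, rising_succ_left (x + y), Finset.Nat.sum_antidiagonal_eq_sum_range_succ_mk,
      Finset.Nat.sum_antidiagonal_eq_sum_range_succ_mk, add_mul]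
    have hx := ih (x + 1) y
    have hy := ih x (y + 1)
    rw [show x + (y + 1) = x + y + 1 by ring] at hy
    rw [show x + 1 + y = x + y + 1 by ring] at hx
    nth_rewrite 1 [← hx]
    rw [add_comm, ← hy, Finset.mul_sum, Finset.mul_sum]
    congr 1
    · refine Finset.sum_congr rfl fun m hm => ?_
      rw [rising_succ_left, Nat.choose_symm (Nat.lt_succ_iff.1 (Finset.mem_range.1 hm))]
      ring
    · refine Finset.sum_congr rfl fun m _ => ?_
      rw [rising_succ_left]
      ring

/-- The scalar by which `∑_m F^m E^m (1/m!) ∏_{j<m} (a - j)⁻¹` acts on the vector of weight `h` in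
the irreducible `sl_2`-module of highest weight `h + 2k`. -/
lemma sum_feValue (h a : ℂ) (k M : ℕ) (hM : k < M) (ha : ∀ j < k, a - j ≠ 0) :
    ∑ m ∈ Finset.range M, (1 / (m.factorial : ℂ) * ∏ j ∈ Finset.range m, (a - j)⁻¹) *
        ∏ i ∈ Finset.range m, (feValue h k - feValue h i) =
      ∏ j ∈ Finset.range k, (a + h + 2 + j) / (a - j) := by
  have hfac : ∀ i, feValue h k - feValue h i = ((k : ℂ) - i) * (h + 1 + k + i) :=
    fun i => by simp only [feValue]; ring
  have hvan : ∀ m, k < m → ∏ i ∈ Finset.range m, (feValue h k - feValue h i) = 0 :=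
    fun m hm => Finset.prod_eq_zero (Finset.mem_range.2 hm) (sub_self _)
  rw [← Finset.sum_subset (Finset.range_mono (Nat.succ_le_of_lt hM)) fun m _ hm => by
    rw [hvan m (by simpa using hm), mul_zero]]
  have hprod : ∏ j ∈ Finset.range k, (a - j) ≠ 0 :=
    Finset.prod_ne_zero_iff.2 fun j hj => ha j (Finset.mem_range.1 hj)
  rw [Finset.prod_div_distrib, eq_div_iff hprod, Finset.sum_mul]
  have hR : ∏ j ∈ Finset.range k, (a + h + 2 + j) = rising ((h + 1 + k) + (a - k + 1)) k := by
    refine Finset.prod_congr rfl fun j _ => by ring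
  rw [hR, ← sum_choose_rising]
  refine Finset.sum_congr rfl fun m hm => ?_
  have hmk : m ≤ k := Nat.lt_succ_iff.1 (Finset.mem_range.1 hm)
  have h1 : ∏ i ∈ Finset.range m, ((k : ℂ) - i) = (k.choose m : ℂ) * m.factorial := by
    rw [mul_comm, ← Nat.cast_mul, ← Nat.descFactorial_eq_factorial_mul_choose,
      Nat.descFactorial_eq_prod_range, Nat.cast_prod]
    refine Finset.prod_congr rfl fun i hi => ?_
    rw [Nat.cast_sub ((Finset.mem_range.1 hi).le.trans hmk)]
  have h2 : ∏ j ∈ Finset.range k, (a - j) =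
      (∏ j ∈ Finset.range m, (a - j)) * rising (a - k + 1) (k - m) := by
    rw [← Finset.prod_range_mul_prod_Ico _ hmk, Finset.prod_Ico_eq_prod_range, rising,
      ← Finset.prod_range_reflect (fun i => a - k + 1 + (i : ℂ))]
    congr 1
    refine Finset.prod_congr rfl fun j hj => ?_
    have hj' := Finset.mem_range.1 hj
    rw [show k - m - 1 - j = k - (m + 1 + j) by omega, Nat.cast_sub (by omega)]
    push_cast
    ring
  have h3 : ∏ j ∈ Finset.range m, (a - j) ≠ 0 :=
    Finset.prod_ne_zero_iff.2 fun j hj => ha j ((Finset.mem_range.1 hj).trans_le hmk)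
  have h4 : (m.factorial : ℂ) ≠ 0 := Nat.cast_ne_zero.2 m.factorial_ne_zero
  simp only [hfac]
  rw [Finset.prod_mul_distrib, h1, h2, Finset.prod_inv_distrib]
  change _ * (_ * rising (h + 1 + k) m) * _ = _
  field_simp

end Sl2

/-! ### Functions on a space spread over `ℂ^n` -/

section Spread

/-- A continuous logarithm of a differentiable function is differentiable. -/
lemma hasDerivAt_of_exp_eq {l g : ℂ → ℂ} {g' t : ℂ} (hl : ContinuousAt l t)
    (hg : HasDerivAt g g' t) (h : ∀ᶠ x in nhds t, Complex.exp (l x) = g x) :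
    HasDerivAt l (g' / g t) t := by
  have ht : Complex.exp (l t) = g t := h.self_of_nhds
  have hgt : g t ≠ 0 := ht ▸ Complex.exp_ne_zero _
  have h1 : HasDerivAt (fun x => l t + Complex.log (g x / g t)) (g' / g t) t := by
    have h2 : HasDerivAt (fun x => g x / g t) (g' / g t) t := hg.div_const _
    have h3 := h2.clog (by rw [div_self hgt]; exact Complex.one_mem_slitPlane)
    rw [div_self hgt, div_one] at h3
    exact h3.const_add _
  refine h1.congr_of_eventuallyEq ?_
  have h4 : Filter.Tendsto (fun x => (l x - l t).im) (nhds t) (nhds 0) := by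
    have : ContinuousAt (fun x => (l x - l t).im) t :=
      Complex.continuous_im.continuousAt.comp (hl.sub continuousAt_const)
    simpa [ContinuousAt] using this
  filter_upwards [h, h4.eventually (Ioo_mem_nhds (neg_lt_zero.2 Real.pi_pos) Real.pi_pos)]
    with x hx him
  rw [← hx, ← ht, ← Complex.exp_sub, Complex.log_exp him.1 him.2.le]
  ring

/-- A function on a ball of `ℂ^n` whose partial derivatives exist and vanish is constant. -/
lemma eq_of_partialDeriv_eq_zero {n : ℕ} {F : (Fin n → ℂ) → ℂ} {x₀ : Fin n → ℂ} {r : ℝ}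
    (hr : 0 < r) (hF : ∀ x ∈ Metric.ball x₀ r, ∀ k,
      HasDerivAt (fun t => F (Function.update x k t)) 0 (x k)) :
    ∀ x ∈ Metric.ball x₀ r, F x = F x₀ := by
  intro x hx
  have hmem : ∀ z : Fin n → ℂ, z ∈ Metric.ball x₀ r ↔ ∀ k, z k ∈ Metric.ball (x₀ k) r := by
    intro z
    simp only [Metric.mem_ball, dist_pi_lt_iff hr]
  have key : ∀ s : Finset (Fin n), F (s.piecewise x x₀) = F x₀ := by
    intro s
    induction s using Finset.induction_on with
    | empty => simp
    | insert k s hk ih =>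
      rw [← ih]
      set z := s.piecewise x x₀ with hz
      have hzb : z ∈ Metric.ball x₀ r := by
        rw [hmem]
        intro j
        by_cases hj : j ∈ s
        · simpa [hz, hj] using (hmem x).1 hx j
        · simpa [hz, hj] using hr
      have hd : ∀ t ∈ Metric.ball (x₀ k) r,
          HasDerivAt (fun t => F (Function.update z k t)) 0 t := by
        intro t ht
        have hb : Function.update z k t ∈ Metric.ball x₀ r := by
          rw [hmem] at hzb ⊢
          intro j
          by_cases hj : j = k
          · subst hj
            simpa using ht
          · simpa [hj] using hzb j
        simpa using hF _ hb k
      have hc := (Metric.isOpen_ball (x := x₀ k) (ε := r)).is_const_of_deriv_eq_zero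
        (convex_ball (x₀ k) r).isPreconnected
        (fun t ht => (hd t ht).differentiableAt.differentiableWithinAt)
        (fun t ht => (hd t ht).deriv) ((hmem x).1 hx k) ((hmem z).1 hzb k)
      rw [Function.update_eq_self] at hc
      rw [← hc]
      congr 1
      exact Finset.piecewise_insert s x x₀ k
  simpa using key Finset.univ

variable {Y : Type*} [TopologicalSpace Y] {n : ℕ} {p : Y → Fin n → ℂ}

/-- Two local inverses of `p` agree near a common point. -/
lemma symm_eventuallyEq {s s' : OpenPartialHomeomorph Y (Fin n → ℂ)} (hs : ⇑s = p) (hs' : ⇑s' = p)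
    {y : Y} (hy : y ∈ s.source) (hy' : y ∈ s'.source) : s'.symm =ᶠ[nhds (p y)] s.symm := by
  have h1 : ∀ᶠ x in nhds (p y), s.symm x ∈ s'.source := by
    rw [← hs]
    exact (s.tendsto_symm hy).eventually (s'.open_source.mem_nhds hy')
  have h2 : ∀ᶠ x in nhds (p y), x ∈ s.target := by
    rw [← hs]
    exact s.open_target.mem_nhds (s.map_source hy)
  filter_upwards [h1, h2] with x hx1 hx2
  have h3 : s' (s.symm x) = x := by rw [hs', ← hs, s.right_inv hx2]
  rw [← s'.left_inv hx1, h3]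

/-- The lift to `Y` of the coordinate line through `p y` in the direction `k`. -/
def lineLift (p : Y → Fin n → ℂ) (s : OpenPartialHomeomorph Y (Fin n → ℂ)) (y : Y) (k : Fin n)
    (t : ℂ) : Y := s.symm (Function.update (p y) k t)

variable {s : OpenPartialHomeomorph Y (Fin n → ℂ)} (hs : ⇑s = p) {y : Y} (hy : y ∈ s.source)
  (k : Fin n)
include hs hy

lemma lineLift_self : lineLift p s y k (p y k) = y := by
  rw [lineLift, Function.update_eq_self, ← hs, s.left_inv hy]

omit hs hy in
lemma tendsto_update (x : Fin n → ℂ) (k : Fin n) :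
    Filter.Tendsto (fun t => Function.update x k t) (nhds (x k)) (nhds x) := by
  have h : Continuous fun t : ℂ => Function.update x k t := continuous_const.update k continuous_id
  simpa using h.tendsto (x k)

lemma continuousAt_lineLift : ContinuousAt (lineLift p s y k) (p y k) := by
  have h1 := s.tendsto_symm hy
  rw [hs] at h1
  have h2 := h1.comp (tendsto_update (p y) k)
  rwa [ContinuousAt, lineLift_self hs hy]

lemma eventually_lineLift :
    ∀ᶠ t in nhds (p y k), p (lineLift p s y k t) = Function.update (p y) k t := by
  have h1 : ∀ᶠ x in nhds (p y), x ∈ s.target := by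
    rw [← hs]
    exact s.open_target.mem_nhds (s.map_source hy)
  filter_upwards [(tendsto_update (p y) k).eventually h1] with t ht
  have h2 := s.right_inv ht
  rwa [hs] at h2

omit hs hy in
lemma hasDerivAt_update (x : Fin n → ℂ) (k l : Fin n) (t : ℂ) :
    HasDerivAt (fun t => Function.update x k t l) (if l = k then 1 else 0) t := by
  by_cases h : l = k
  · subst h
    simpa using hasDerivAt_id' t
  · simpa [h] using hasDerivAt_const t (x l)

lemma hasDerivAt_logz {logz : Y → Fin n → ℂ} (hc : Continuous logz)
    (he : ∀ y k, Complex.exp (logz y k) = p y k) (l : Fin n) :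
    HasDerivAt (fun t => logz (lineLift p s y k t) l) ((if l = k then 1 else 0) / p y l)
      (p y k) := by
  have h1 := hasDerivAt_of_exp_eq (l := fun t => logz (lineLift p s y k t) l)
    (g := fun t => Function.update (p y) k t l) (t := p y k) ?_ (hasDerivAt_update (p y) k l _) ?_
  · simpa using h1
  · have h2 : Continuous fun y' => logz y' l := (continuous_apply l).comp hc
    exact h2.continuousAt.comp (continuousAt_lineLift hs hy k)
  · filter_upwards [eventually_lineLift hs hy k] with t ht
    rw [he, ht]

lemma hasDerivAt_logd {logd : Y → Fin n → Fin n → ℂ} {a b : Fin n}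
    (hc : Continuous fun y => logd y a b)
    (he : ∀ y, Complex.exp (logd y a b) = p y a - p y b) :
    HasDerivAt (fun t => logd (lineLift p s y k t) a b)
      (((if a = k then 1 else 0) - (if b = k then 1 else 0)) / (p y a - p y b)) (p y k) := by
  have h1 := hasDerivAt_of_exp_eq (l := fun t => logd (lineLift p s y k t) a b)
    (g := fun t => Function.update (p y) k t a - Function.update (p y) k t b) (t := p y k) ?_
    ((hasDerivAt_update (p y) k a _).sub (hasDerivAt_update (p y) k b _)) ?_
  · simpa using h1
  · exact hc.continuousAt.comp (continuousAt_lineLift hs hy k)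
  · filter_upwards [eventually_lineLift hs hy k] with t ht
    rw [he, ht]

omit hs hy in
/-- The partial derivative can be computed with any local inverse of `p`. -/
lemma HasPartialDerivAt.hasDerivAt {W : Type*} [AddCommGroup W] [Module ℂ W] {f : Y → W} {w : W}
    (h : HasPartialDerivAt p k f w y) (hs : ⇑s = p) (hy : y ∈ s.source) (φ : Dual ℂ W) :
    HasDerivAt (fun t => φ (f (lineLift p s y k t))) (φ w) (p y k) := by
  obtain ⟨s', hy', hs', hd⟩ := h
  refine (hd φ).congr_of_eventuallyEq ?_
  filter_upwards [(tendsto_update (p y) k).eventually (symm_eventuallyEq hs' hs hy' hy)] with t ht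
  rw [lineLift, ht]

omit hs hy in
lemma isLocallyConstant_of_hasDerivAt_zero (hp : IsLocalHomeomorph p) {G : Y → ℂ}
    (hG : ∀ s : OpenPartialHomeomorph Y (Fin n → ℂ), ⇑s = p → ∀ y ∈ s.source, ∀ k,
      HasDerivAt (fun t => G (lineLift p s y k t)) 0 (p y k)) : IsLocallyConstant G := by
  rw [IsLocallyConstant.iff_eventually_eq]
  intro y₀
  obtain ⟨s, hy₀, hs⟩ := hp y₀
  have hs : ⇑s = p := hs.symm
  obtain ⟨r, hr, hball⟩ := Metric.mem_nhds_iff.1 (s.open_target.mem_nhds (s.map_source hy₀))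
  have hconst := eq_of_partialDeriv_eq_zero (F := fun x => G (s.symm x)) hr fun x hx k => by
    have h1 := hG s hs (s.symm x) (s.map_target (hball hx)) k
    have h2 : p (s.symm x) = x := by rw [← hs, s.right_inv (hball hx)]
    simp only [lineLift, h2] at h1
    exact h1
  have h3 : ∀ᶠ y in nhds y₀, s y ∈ Metric.ball (s y₀) r :=
    (s.continuousAt hy₀).eventually (Metric.ball_mem_nhds _ hr)
  filter_upwards [h3, s.open_source.mem_nhds hy₀] with y hy1 hy2
  have h4 := hconst _ hy1
  simpa only [s.left_inv hy2, s.left_inv hy₀] using h4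

end Spread

variable {L : Type*} [LieRing L] [LieAlgebra ℂ L] [FiniteDimensional ℂ L] [LieAlgebra.IsSimple ℂ L]

namespace RootData

variable {H : LieSubalgebra ℂ L} [H.IsCartanSubalgebra] (D : RootData H)

/-! ### Heights of roots and of affine roots -/

lemma rt_injective : Function.Injective D.rt := (IsKilling.rootSystem H).root.injective

lemma rt_reflectionPerm (α β : H.root) :
    D.rt ((IsKilling.rootSystem H).reflectionPerm β α) =
      D.rt α - ((IsKilling.rootSystem H).pairingIn ℤ α β : ℂ) • D.rt β := by
  have h := (IsKilling.rootSystem H).algebraMap_pairingIn ℤ α β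
  simp only [algebraMap_int_eq, eq_intCast] at h
  rw [h, rt, RootPairing.root_reflectionPerm, RootPairing.reflection_apply_root]
  rfl

lemma rt_corootVec (α β : H.root) :
    D.rt α (D.corootVec β) = ((IsKilling.rootSystem H).pairingIn ℤ α β : ℂ) := by
  have h := (IsKilling.rootSystem H).algebraMap_pairingIn ℤ α β
  simp only [algebraMap_int_eq, eq_intCast] at h
  rw [h]
  rfl

lemma rt_corootVec_self (β : H.root) : D.rt β (D.corootVec β) = 2 := by
  simp [rt_corootVec]

/-- The sum `ρ^∨` of the dual fundamental weights. -/
def rhoVec : H := ∑ i, D.fundCoweight i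

lemma rhoVec_mem : D.rhoVec ∈ D.coweightLattice :=
  Submodule.sum_mem _ fun i _ => Submodule.subset_span ⟨i, rfl⟩

lemma rt_simple_rhoVec (i : D.base.support) : D.rt i D.rhoVec = 1 := by
  classical
  rw [rhoVec, map_sum]
  simp [rt_fundCoweight]

lemma rt_rhoVec (α : H.root) : D.rt α D.rhoVec = (D.base.height α : ℂ) := by
  obtain ⟨f, -, -, hf⟩ := D.base.exists_root_eq_sum_int α
  rw [RootPairing.Base.height_eq_sum hf]
  have h : D.rt α = ∑ j ∈ D.base.support, f j • D.rt j := hf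
  rw [h, LinearMap.sum_apply, Int.cast_sum]
  refine Finset.sum_congr rfl fun j hj => ?_
  rw [LinearMap.smul_apply, D.rt_simple_rhoVec ⟨j, hj⟩]
  simp

lemma height_neg (α : H.root) : D.base.height (D.neg α) = -D.base.height α := by
  have h := D.rt_rhoVec (D.neg α)
  rw [rt_neg, LinearMap.neg_apply, rt_rhoVec] at h
  exact_mod_cast h.symm

lemma height_refl (α β : H.root) :
    D.base.height ((IsKilling.rootSystem H).reflectionPerm β α) =
      D.base.height α - (IsKilling.rootSystem H).pairingIn ℤ α β * D.base.height β := by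
  have h := D.rt_rhoVec ((IsKilling.rootSystem H).reflectionPerm β α)
  rw [rt_reflectionPerm, LinearMap.sub_apply, LinearMap.smul_apply, rt_rhoVec, rt_rhoVec, smul_eq_mul] at h
  exact_mod_cast h.symm

/-- The maximal root is the only root of maximal height. -/
lemma height_le_theta (α : H.root) :
    D.base.height α ≤ D.base.height D.θ ∧ (D.base.height α = D.base.height D.θ → α = D.θ) := by
  obtain ⟨c, hc⟩ := D.θ_maximal α
  have h : D.base.height D.θ = D.base.height α + ∑ i, (c i : ℤ) := by
    have h1 := D.rt_rhoVec D.θ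
    have h2 : D.rt D.θ = D.rt α + ∑ i : D.base.support, c i • D.rt i := hc
    rw [h2, LinearMap.add_apply, LinearMap.sum_apply, rt_rhoVec] at h1
    simp only [LinearMap.smul_apply, rt_simple_rhoVec, nsmul_eq_mul, mul_one] at h1
    exact_mod_cast h1.symm
  refine ⟨by rw [h]; simpa using Finset.sum_nonneg fun i _ => Int.natCast_nonneg (c i), fun he => ?_⟩
  have h0 : ∑ i, (c i : ℤ) = 0 := by omega
  have hc0 : ∀ i, c i = 0 := fun i => by
    have := (Finset.sum_eq_zero_iff_of_nonneg fun i _ => Int.natCast_nonneg (c i)).1 h0 i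
      (Finset.mem_univ i)
    exact_mod_cast this
  refine (IsKilling.rootSystem H).root.injective ?_
  rw [hc]
  simp [hc0]

lemma neg_neg_root (α : H.root) : D.neg (D.neg α) = α := by
  refine D.rt_injective ?_
  rw [rt_neg, rt_neg, neg_neg]

lemma neg_theta_of_height_le {α : H.root} (h : D.base.height α ≤ -D.base.height D.θ) :
    α = D.neg D.θ := by
  have h1 := D.height_le_theta (D.neg α)
  rw [height_neg] at h1
  rw [← h1.2 (by omega), neg_neg_root]

lemma height_theta_pos : 0 < D.base.height D.θ := by
  have h1 := D.height_le_theta (D.neg D.θ)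
  rw [height_neg] at h1
  have h2 := D.base.height_ne_zero D.θ
  omega

/-- The height of an affine root: the linear function equal to `1` on the simple affine roots. An
affine root is positive exactly when its height is. -/
def affHeight (a : D.AffRoot) : ℤ := D.base.height a.1 + a.2 * (D.base.height D.θ + 1)

lemma affHeight_simple (j : Option D.base.support) : D.affHeight (D.simpleAff j) = 1 := by
  cases j with
  | none => simp [affHeight, simpleAff, height_neg]
  | some i => simp [affHeight, simpleAff, RootPairing.Base.height_one_of_mem_support i.2]

lemma affHeight_ne_zero (a : D.AffRoot) : D.affHeight a ≠ 0 := by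
  intro h
  have h0 := D.base.height_ne_zero a.1
  have h1 := (D.height_le_theta a.1).1
  have h2 := (D.height_le_theta (D.neg a.1)).1
  rw [height_neg] at h2
  rw [affHeight] at h
  rcases lt_trichotomy a.2 0 with h3 | h3 | h3
  · nlinarith
  · rw [h3] at h; omega
  · nlinarith

lemma affHeight_refl (β a : D.AffRoot) :
    D.affHeight (D.affRefl β a) =
      D.affHeight a - (IsKilling.rootSystem H).pairingIn ℤ a.1 β.1 * D.affHeight β := by
  simp only [affHeight, affRefl, height_refl]
  ring

/-- Realization of the affine roots as vectors of `H^* ⊕ ℂ δ`. -/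
def affVec (a : D.AffRoot) : Dual ℂ H × ℂ := (D.rt a.1, a.2)

lemma affVec_injective : Function.Injective D.affVec := by
  rintro ⟨α, j⟩ ⟨β, k⟩ h
  simp only [affVec, Prod.mk.injEq, Int.cast_inj] at h
  exact Prod.ext (D.rt_injective h.1) h.2

lemma affVec_refl (β a : D.AffRoot) :
    D.affVec (D.affRefl β a) = D.affVec a - D.rt a.1 (D.corootVec β.1) • D.affVec β := by
  refine Prod.ext ?_ ?_
  · simp only [affVec, affRefl, rt_reflectionPerm, rt_corootVec, Prod.fst_sub, Prod.smul_fst]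
  · simp only [affVec, affRefl, rt_corootVec, Prod.snd_sub, Prod.smul_snd, smul_eq_mul]
    push_cast
    rfl

lemma affRefl_involutive (β : D.AffRoot) : Function.Involutive (D.affRefl β) := by
  intro a
  refine D.affVec_injective ?_
  rw [affVec_refl, affVec_refl]
  simp only [affRefl, rt_reflectionPerm, LinearMap.sub_apply, LinearMap.smul_apply,
    rt_corootVec_self, smul_eq_mul]
  rw [rt_corootVec]
  module

lemma affRefl_affRefl (β γ a : D.AffRoot) :
    D.affRefl (D.affRefl β γ) a = D.affRefl β (D.affRefl γ (D.affRefl β a)) := by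
  refine D.affVec_injective ?_
  have h1 : D.rt a.1 (D.corootVec (D.affRefl β γ).1) = D.rt (D.affRefl β a).1 (D.corootVec γ.1) :=
    (IsKilling.rootSystem H).pairing_reflectionPerm β.1 a.1 γ.1
  rw [affVec_refl, h1]
  simp only [affVec_refl]
  have h3 := D.rt_corootVec (D.affRefl β a).1 γ.1
  simp only [affRefl, rt_reflectionPerm, LinearMap.sub_apply, LinearMap.smul_apply,
    rt_corootVec_self, smul_eq_mul] at h3 ⊢
  rw [← h3, ← rt_corootVec]
  module

/-- The affine root `-a`. -/
def affNeg (a : D.AffRoot) : D.AffRoot := (D.neg a.1, -a.2)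

lemma affVec_neg (a : D.AffRoot) : D.affVec (D.affNeg a) = -D.affVec a := by
  simp [affVec, affNeg, rt_neg]

lemma affHeight_neg (a : D.AffRoot) : D.affHeight (D.affNeg a) = -D.affHeight a := by
  simp only [affHeight, affNeg, height_neg]
  ring

lemma affRefl_self (a : D.AffRoot) : D.affRefl a a = D.affNeg a := by
  refine D.affVec_injective ?_
  rw [affVec_refl, affVec_neg, rt_corootVec_self]
  module

lemma affRefl_neg (β a : D.AffRoot) : D.affRefl β (D.affNeg a) = D.affNeg (D.affRefl β a) := by
  refine D.affVec_injective ?_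
  rw [affVec_refl, affVec_neg, affVec_neg, affVec_refl]
  simp only [affNeg, rt_neg, LinearMap.neg_apply]
  module

lemma wordAct_neg (js : List (Option D.base.support)) (a : D.AffRoot) :
    D.wordAct js (D.affNeg a) = D.affNeg (D.wordAct js a) := by
  induction js generalizing a with
  | nil => rfl
  | cons j js ih => rw [wordAct, wordAct, affRefl_neg, ih]

/-- A simple affine reflection permutes the positive affine roots other than its own root. -/
lemma affHeight_simple_refl_pos {a : D.AffRoot} (ha : 0 < D.affHeight a)
    (j : Option D.base.support) (hj : a ≠ D.simpleAff j) :
    0 < D.affHeight (D.affRefl (D.simpleAff j) a) := by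
  have hθ := D.height_theta_pos
  have hle := (D.height_le_theta a.1).1
  have hge := (D.height_le_theta (D.neg a.1)).1
  rw [height_neg] at hge
  cases j with
  | none =>
    rw [affHeight_refl, affHeight_simple, mul_one]
    have hp : (IsKilling.rootSystem H).pairingIn ℤ a.1 (D.simpleAff none).1 =
        -(IsKilling.rootSystem H).pairingIn ℤ a.1 D.θ :=
      RootPairing.pairingIn_reflectionPerm_self_right ..
    rw [hp, sub_neg_eq_add]
    have hr := D.height_refl a.1 D.θ
    set p := (IsKilling.rootSystem H).pairingIn ℤ a.1 D.θ with hpdef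
    have hr1 := (D.height_le_theta ((IsKilling.rootSystem H).reflectionPerm D.θ a.1)).1
    rw [hr] at hr1
    by_cases hneg : a.1 = D.neg D.θ
    · have hp2 : p = -2 := by
        rw [hpdef, hneg]
        have := RootPairing.pairingIn_reflectionPerm_self_left (S := ℤ)
          (IsKilling.rootSystem H) D.θ D.θ
        rw [RootPairing.pairingIn_same] at this
        exact this
      have ha2 : a.2 ≠ 1 := fun h => hj (Prod.ext hneg h)
      rw [affHeight, hneg, height_neg] at ha ⊢
      rw [hp2]
      have : 1 ≤ a.2 := by
        by_contra! hlt
        nlinarith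
      have : 2 ≤ a.2 := by omega
      nlinarith
    -- for `α ≠ -θ` the root `s_θ α = α - p θ` cannot be higher than `θ`, which bounds `p` from below
    · have hgt : -D.base.height D.θ < D.base.height a.1 := by
        by_contra! hlt
        exact hneg (D.neg_theta_of_height_le hlt)
      have hp1 : -1 ≤ p := by
        by_contra! hlt
        nlinarith
      by_cases hp0 : 0 ≤ p
      · omega
      · have hp' : p = -1 := by omega
        have hlt : D.base.height a.1 < 0 := by
          rw [hp'] at hr1
          have := D.base.height_ne_zero a.1
          omega
        rw [affHeight] at ha ⊢
        have : 1 ≤ a.2 := by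
          by_contra! hlt
          nlinarith
        rw [hp']
        nlinarith
  | some i =>
    rw [affHeight] at ha ⊢
    simp only [affRefl, simpleAff, mul_zero, sub_zero]
    have hle' := (D.height_le_theta ((IsKilling.rootSystem H).reflectionPerm i a.1)).1
    have hge' := (D.height_le_theta (D.neg ((IsKilling.rootSystem H).reflectionPerm i a.1))).1
    rw [height_neg] at hge'
    rcases lt_trichotomy a.2 0 with h2 | h2 | h2
    · nlinarith
    · rw [h2, zero_mul, add_zero] at ha ⊢
      refine RootPairing.Base.IsPos.reflectionPerm (b := D.base) ha i.2 fun h => ?_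
      exact hj (Prod.ext h h2)
    · nlinarith

/-! ### Reduced words and their inversions -/

/-- A shortest word for its element of the affine Weyl group. -/
def IsShortest (js : List (Option D.base.support)) : Prop :=
  ∀ js', D.wordAct js' = D.wordAct js → js.length ≤ js'.length

variable {D}

lemma IsShortest.tail {j : Option D.base.support} {js : List (Option D.base.support)}
    (h : D.IsShortest (j :: js)) : D.IsShortest js := by
  intro js' hjs'
  have := h (j :: js') (by funext a; rw [wordAct, wordAct, hjs'])
  simpa using this

/-- Multiplying an element of the affine Weyl group by the reflection in one of the roots of a word
deletes a letter of the word. -/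
lemma exists_delete {js : List (Option D.base.support)} {r : D.AffRoot} (hr : r ∈ D.wordRoots js) :
    ∃ js', js'.length + 1 = js.length ∧ ∀ a, D.wordAct js' a = D.wordAct js (D.affRefl r a) := by
  induction js generalizing r with
  | nil => simp [wordRoots] at hr
  | cons k ks ih =>
    rw [wordRoots, List.mem_cons, List.mem_map] at hr
    obtain rfl | ⟨r', hr', rfl⟩ := hr
    · exact ⟨ks, rfl, fun a => by rw [wordAct, affRefl_involutive]⟩
    · obtain ⟨ks', hlen, hks'⟩ := ih hr'
      refine ⟨k :: ks', by simpa using hlen, fun a => ?_⟩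
      rw [wordAct, wordAct, affRefl_affRefl, affRefl_involutive, hks']

lemma IsShortest.simple_notMem {j : Option D.base.support} {js : List (Option D.base.support)}
    (h : D.IsShortest (j :: js)) : D.simpleAff j ∉ D.wordRoots js := by
  intro hj
  obtain ⟨js', hlen, hjs'⟩ := exists_delete hj
  have := h js' (funext fun a => by rw [hjs', wordAct])
  rw [List.length_cons] at this
  omega

lemma IsShortest.affHeight_pos {js : List (Option D.base.support)} (h : D.IsShortest js) :
    ∀ r ∈ D.wordRoots js, 0 < D.affHeight r := by
  induction js with
  | nil => simp [wordRoots]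
  | cons j js ih =>
    intro r hr
    rw [wordRoots, List.mem_cons, List.mem_map] at hr
    obtain rfl | ⟨r', hr', rfl⟩ := hr
    · rw [affHeight_simple]
      exact Int.one_pos
    · refine D.affHeight_simple_refl_pos (ih h.tail r' hr') j fun he => ?_
      exact h.simple_notMem (he ▸ hr')

/-- The roots of a reduced word are distinct. -/
lemma IsShortest.nodup {js : List (Option D.base.support)} (h : D.IsShortest js) :
    (D.wordRoots js).Nodup := by
  induction js with
  | nil => simp [wordRoots]
  | cons j js ih =>
    rw [wordRoots, List.nodup_cons, List.mem_map]
    refine ⟨?_, (ih h.tail).map (D.affRefl_involutive _).injective⟩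
    rintro ⟨r, hr, he⟩
    have h1 := h.tail.affHeight_pos r hr
    rw [← D.affRefl_involutive (D.simpleAff j) r, he, affRefl_self, affHeight_neg,
      affHeight_simple] at h1
    omega

/-- The roots of a reduced word for `w` are the positive affine roots made negative by `w`. -/
lemma IsShortest.mem_wordRoots {js : List (Option D.base.support)} (h : D.IsShortest js)
    (a : D.AffRoot) :
    a ∈ D.wordRoots js ↔ 0 < D.affHeight a ∧ D.affHeight (D.wordAct js a) < 0 := by
  induction js generalizing a with
  | nil =>
    simp only [wordRoots, wordAct, List.not_mem_nil, false_iff]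
    omega
  | cons j js ih =>
    have hj := h.simple_notMem
    rw [wordRoots, List.mem_cons, List.mem_map, wordAct]
    by_cases ha : a = D.simpleAff j
    · rw [ih h.tail, affHeight_simple] at hj
      have := D.affHeight_ne_zero (D.wordAct js (D.simpleAff j))
      rw [ha, affRefl_self, wordAct_neg, affHeight_neg, affHeight_simple]
      simp only [true_or, true_iff]
      omega
    · have h1 : (∃ r ∈ D.wordRoots js, D.affRefl (D.simpleAff j) r = a) ↔
          D.affRefl (D.simpleAff j) a ∈ D.wordRoots js :=
        ⟨by rintro ⟨r, hr, rfl⟩; rwa [affRefl_involutive],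
          fun hr => ⟨_, hr, D.affRefl_involutive _ a⟩⟩
      rw [h1, ih h.tail]
      simp only [ha, false_or]
      refine and_congr_left fun hneg => ⟨fun hp => ?_, fun hp =>
        D.affHeight_simple_refl_pos hp j ha⟩
      rw [← D.affRefl_involutive (D.simpleAff j) a]
      refine D.affHeight_simple_refl_pos hp j fun he => hj ?_
      rw [ih h.tail, ← he]
      exact ⟨hp, hneg⟩

variable (D)

/-! ### The roots of a reduced presentation of a translation -/

/-- The linear extension of an affine reflection. -/
def affReflLin (β : D.AffRoot) : (Dual ℂ H × ℂ) →ₗ[ℂ] (Dual ℂ H × ℂ) :=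
  LinearMap.id - ((Module.Dual.eval ℂ H (D.corootVec β.1)) ∘ₗ LinearMap.fst ℂ _ _).smulRight
    (D.affVec β)

lemma affReflLin_affVec (β a : D.AffRoot) :
    D.affReflLin β (D.affVec a) = D.affVec (D.affRefl β a) := by
  rw [affVec_refl]
  simp [affReflLin, affVec]

lemma affReflLin_involutive (β : D.AffRoot) : Function.Involutive (D.affReflLin β) := by
  intro x
  simp only [affReflLin, LinearMap.sub_apply, LinearMap.id_apply, LinearMap.smulRight_apply,
    LinearMap.comp_apply, LinearMap.fst_apply, Dual.eval_apply, Prod.fst_sub, Prod.smul_fst,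
    affVec, LinearMap.smul_apply, rt_corootVec_self, smul_eq_mul]
  module

lemma exists_wordAct_lin (js : List (Option D.base.support)) :
    ∃ W : (Dual ℂ H × ℂ) ≃ₗ[ℂ] (Dual ℂ H × ℂ), ∀ a, D.affVec (D.wordAct js a) = W (D.affVec a) := by
  induction js with
  | nil => exact ⟨LinearEquiv.refl _ _, fun a => rfl⟩
  | cons j js ih =>
    obtain ⟨W, hW⟩ := ih
    refine ⟨(LinearEquiv.ofInvolutive _ (D.affReflLin_involutive (D.simpleAff j))).trans W,
      fun a => ?_⟩
    rw [wordAct, hW, ← affReflLin_affVec]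
    rfl

lemma wordAct_surjective (js : List (Option D.base.support)) :
    Function.Surjective (D.wordAct js) := by
  induction js with
  | nil => exact fun a => ⟨a, rfl⟩
  | cons j js ih => exact ih.comp (D.affRefl_involutive _).surjective

/-- The linear extension of `affHeight`. -/
def affHeightLin : (Dual ℂ H × ℂ) →ₗ[ℂ] ℂ :=
  (Module.Dual.eval ℂ H D.rhoVec) ∘ₗ LinearMap.fst ℂ _ _ +
    ((D.base.height D.θ : ℂ) + 1) • LinearMap.snd ℂ _ _

lemma affHeightLin_affVec (a : D.AffRoot) : D.affHeightLin (D.affVec a) = (D.affHeight a : ℂ) := by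
  simp only [affHeightLin, affVec, affHeight, LinearMap.add_apply, LinearMap.comp_apply,
    LinearMap.fst_apply, LinearMap.snd_apply, LinearMap.smul_apply, Dual.eval_apply, rt_rhoVec]
  push_cast
  rw [smul_eq_mul, mul_comm]

/-- The simple affine roots span `H^* ⊕ ℂ δ`. -/
lemma lin_ext_simple {f g : (Dual ℂ H × ℂ) →ₗ[ℂ] ℂ}
    (h : ∀ j, f (D.affVec (D.simpleAff j)) = g (D.affVec (D.simpleAff j))) : f = g := by
  have h1 : f ∘ₗ LinearMap.inl ℂ _ _ = g ∘ₗ LinearMap.inl ℂ _ _ := by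
    refine D.base.toWeightBasis.ext fun i => ?_
    have := h (some i)
    rw [RootPairing.Base.toWeightBasis_apply]
    simpa [affVec, simpleAff, rt] using this
  refine LinearMap.prod_ext h1 (LinearMap.ext_ring ?_)
  have h2 := h none
  have h3 : D.affVec (D.simpleAff none) = LinearMap.inl ℂ _ _ (D.rt (D.neg D.θ)) +
      LinearMap.inr ℂ (Dual ℂ H) ℂ 1 := by
    simp [affVec, simpleAff]
  rw [h3, map_add, map_add, ← LinearMap.comp_apply, h1, LinearMap.comp_apply] at h2
  exact add_left_cancel h2

variable {D} in
/-- Since `π` permutes the simple affine roots, it preserves heights. -/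
lemma IsReducedPresentation.affHeight_wordAct {ω : H} {js : List (Option D.base.support)}
    (h : D.IsReducedPresentation ω js) (a : D.AffRoot) :
    (D.affHeight (D.wordAct js a) : ℂ) =
      D.base.height a.1 + (a.2 - D.rt a.1 ω) * (D.base.height D.θ + 1) := by
  obtain ⟨⟨π, hπ, hact⟩, -⟩ := h
  obtain ⟨W, hW⟩ := D.exists_wordAct_lin js
  let Tr : (Dual ℂ H × ℂ) →ₗ[ℂ] (Dual ℂ H × ℂ) :=
    LinearMap.id - LinearMap.inr ℂ _ _ ∘ₗ (Module.Dual.eval ℂ H ω) ∘ₗ LinearMap.fst ℂ _ _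
  have hT : ∀ b, D.affVec (π (D.wordAct js b)) = Tr (D.affVec b) := by
    intro b
    refine Prod.ext ?_ ?_
    · simp [Tr, affVec, (hact b).1]
    · simp [Tr, affVec, (hact b).2]
  have key : D.affHeightLin ∘ₗ Tr ∘ₗ W.symm.toLinearMap = D.affHeightLin := by
    refine D.lin_ext_simple fun j => ?_
    obtain ⟨b, hb⟩ := D.wordAct_surjective js (D.simpleAff j)
    obtain ⟨i, hi⟩ : π (D.simpleAff j) ∈ Set.range D.simpleAff := hπ ▸ ⟨_, ⟨j, rfl⟩, rfl⟩
    have h1 : W.symm (D.affVec (D.simpleAff j)) = D.affVec b := by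
      rw [← hb, hW, LinearEquiv.symm_apply_apply]
    rw [LinearMap.comp_apply, LinearMap.comp_apply, LinearEquiv.coe_coe, h1, ← hT, hb, ← hi,
      affHeightLin_affVec, affHeightLin_affVec, affHeight_simple, affHeight_simple]
  have h2 := LinearMap.congr_fun key (D.affVec (D.wordAct js a))
  rw [LinearMap.comp_apply, LinearMap.comp_apply, LinearEquiv.coe_coe, hW,
    LinearEquiv.symm_apply_apply, ← hW, affHeightLin_affVec] at h2
  rw [← h2]
  simp [Tr, affVec, affHeightLin, rt_rhoVec, mul_comm]

/-- For a positive root, `(ω_i^∨, α)` is a natural number. -/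
lemma exists_rt_fundCoweight (i : D.base.support) (α : H.root) (hα : D.base.IsPos α) :
    ∃ m : ℕ, D.rt α (D.fundCoweight i) = m := by
  classical
  obtain ⟨f, -, hf0, hf⟩ := D.base.exists_root_eq_sum_int α
  have hpos : ∀ j, 0 ≤ f j := by
    rcases hf0 with hf0 | hf0
    · exact fun j => hf0.le j
    · have h1 := RootPairing.Base.height_eq_sum hf
      have h2 : ∑ j ∈ D.base.support, f j ≤ 0 := Finset.sum_nonpos fun j _ => hf0.le j
      have h3 : 0 < D.base.height α := hα
      omega
  refine ⟨(f i).toNat, ?_⟩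
  have h : D.rt α = ∑ j ∈ D.base.support, f j • D.rt j := hf
  rw [h, LinearMap.sum_apply, Finset.sum_eq_single (i : H.root)]
  · rw [LinearMap.smul_apply, D.rt_fundCoweight i i, if_pos rfl, zsmul_eq_mul, mul_one]
    exact_mod_cast (Int.toNat_of_nonneg (hpos i)).symm
  · intro j hj hne
    rw [LinearMap.smul_apply, D.rt_fundCoweight i ⟨j, hj⟩, if_neg, smul_zero]
    exact fun he => hne (congrArg Subtype.val he)
  · exact fun hi => absurd i.2 hi

/-- The natural number `(ω_i^∨, α)` for a positive root `α` (and `0` for other roots). -/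
def level (i : D.base.support) (α : H.root) : ℕ :=
  open scoped Classical in
  if hα : D.base.IsPos α then (D.exists_rt_fundCoweight i α hα).choose else 0

lemma rt_fundCoweight_eq_level (i : D.base.support) {α : H.root} (hα : D.base.IsPos α) :
    D.rt α (D.fundCoweight i) = D.level i α := by
  rw [level, dif_pos hα]
  exact (D.exists_rt_fundCoweight i α hα).choose_spec

lemma mem_posRoots {α : H.root} : α ∈ D.posRoots ↔ D.base.IsPos α := by simp [posRoots]

lemma isPos_neg {α : H.root} (h : ¬ D.base.IsPos α) : D.base.IsPos (D.neg α) := by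
  have h1 := D.base.height_ne_zero α
  have h2 : ¬ 0 < D.base.height α := h
  change 0 < D.base.height (D.neg α)
  rw [height_neg]
  omega

variable {D} in
/-- The affine roots of a reduced presentation of `t_{ω_i^∨}` are the `[α, j]` with `α` positive and
`0 ≤ j < (ω_i^∨, α)`. -/
lemma IsReducedPresentation.mem_wordRoots {i : D.base.support} {js : List (Option D.base.support)}
    (h : D.IsReducedPresentation (D.fundCoweight i) js) (a : D.AffRoot) :
    a ∈ D.wordRoots js ↔ D.base.IsPos a.1 ∧ 0 ≤ a.2 ∧ a.2 < D.level i a.1 := by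
  have hs : D.IsShortest js := h.2
  rw [hs.mem_wordRoots]
  have h1 := h.affHeight_wordAct a
  have hle := (D.height_le_theta a.1).1
  have hge := (D.height_le_theta (D.neg a.1)).1
  rw [height_neg] at hge
  by_cases hα : D.base.IsPos a.1
  · have hpos : 0 < D.base.height a.1 := hα
    rw [D.rt_fundCoweight_eq_level i hα] at h1
    have h2 : D.affHeight (D.wordAct js a) =
        D.base.height a.1 + (a.2 - D.level i a.1) * (D.base.height D.θ + 1) := by
      exact_mod_cast h1
    rw [h2, affHeight]
    simp only [hα, true_and]
    constructor
    · rintro ⟨h3, h4⟩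
      constructor
      · by_contra! hlt
        nlinarith
      · by_contra! hlt
        nlinarith
    · rintro ⟨h3, h4⟩
      constructor
      · nlinarith
      · nlinarith
  · have hneg := D.isPos_neg hα
    have h3 := D.rt_fundCoweight_eq_level i hneg
    rw [rt_neg, LinearMap.neg_apply, neg_eq_iff_eq_neg] at h3
    rw [h3] at h1
    have h2 : D.affHeight (D.wordAct js a) =
        D.base.height a.1 + (a.2 + D.level i (D.neg a.1)) * (D.base.height D.θ + 1) := by
      rw [sub_neg_eq_add] at h1
      exact_mod_cast h1
    rw [h2, affHeight]
    have hl : (0 : ℤ) ≤ D.level i (D.neg a.1) := Int.natCast_nonneg _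
    have hθ := D.height_theta_pos
    simp only [hα, false_and, iff_false, not_and]
    intro h4 h5
    nlinarith

variable {D} in
lemma IsReducedPresentation.prod_wordRoots {i : D.base.support}
    {js : List (Option D.base.support)} (h : D.IsReducedPresentation (D.fundCoweight i) js)
    (f : D.AffRoot → ℂ) :
    ((D.wordRoots js).map f).prod =
      ∏ α ∈ D.posRoots, ∏ j ∈ Finset.range (D.level i α), f (α, (j : ℤ)) := by
  classical
  have hs : D.IsShortest js := h.2
  rw [← List.prod_toFinset f hs.nodup, Finset.prod_sigma']
  refine (Finset.prod_bij (fun x _ => ((x.1, (x.2 : ℤ)) : D.AffRoot)) ?_ ?_ ?_ ?_).symm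
  · rintro ⟨α, j⟩ hx
    rw [Finset.mem_sigma, mem_posRoots, Finset.mem_range] at hx
    rw [List.mem_toFinset, h.mem_wordRoots]
    exact ⟨hx.1, Int.natCast_nonneg _, Int.ofNat_lt.2 hx.2⟩
  · rintro ⟨α, j⟩ _ ⟨β, k⟩ _ he
    simp only [Prod.mk.injEq, Nat.cast_inj] at he
    obtain ⟨rfl, rfl⟩ := he
    rfl
  · rintro ⟨α, j⟩ hx
    rw [List.mem_toFinset, h.mem_wordRoots] at hx
    refine ⟨⟨α, j.toNat⟩, ?_, ?_⟩
    · rw [Finset.mem_sigma, mem_posRoots, Finset.mem_range]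
      exact ⟨hx.1, by have := hx.2; dsimp only at this ⊢; omega⟩
    · simp only [Int.toNat_of_nonneg hx.2.1]
  · exact fun _ _ => rfl

end RootData

section Operators

variable {n : ℕ} (V : Fin n → Type*) [∀ k, AddCommGroup (V k)] [∀ k, Module ℂ (V k)]
  [∀ k, LieRingModule L (V k)] [∀ k, LieModule ℂ L (V k)] [∀ k, FiniteDimensional ℂ (V k)]

/-! ### The restriction of operators to a weight subspace -/

section Res

variable (H : LieSubalgebra ℂ L) (ν : Dual ℂ H)

/-- A linear projection of `V` onto `V[ν]`. -/
def weightProj : (⨂[ℂ] i, V i) →ₗ[ℂ] weightSubspace V H ν :=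
  (LinearMap.exists_leftInverse_of_injective (weightSubspace V H ν).subtype
    (Submodule.ker_subtype _)).choose

lemma weightProj_coe (w : weightSubspace V H ν) : weightProj V H ν (w : ⨂[ℂ] i, V i) = w :=
  LinearMap.congr_fun (LinearMap.exists_leftInverse_of_injective (weightSubspace V H ν).subtype
    (Submodule.ker_subtype _)).choose_spec w

/-- The compression of an operator to `V[ν]`. It is linear in the operator, and it is the
restriction of the operator when the latter preserves `V[ν]`. -/
def res : End ℂ (⨂[ℂ] i, V i) →ₗ[ℂ] End ℂ (weightSubspace V H ν) where
  toFun A := weightProj V H ν ∘ₗ A ∘ₗ (weightSubspace V H ν).subtype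
  map_add' A B := by ext; simp
  map_smul' c A := by ext; simp

variable {H ν} {A B : End ℂ (⨂[ℂ] i, V i)}

lemma coe_res (hA : ∀ w ∈ weightSubspace V H ν, A w ∈ weightSubspace V H ν)
    (w : weightSubspace V H ν) : (res V H ν A w : ⨂[ℂ] i, V i) = A w := by
  change ((weightProj V H ν (A w) : weightSubspace V H ν) : ⨂[ℂ] i, V i) = A w
  exact congrArg Subtype.val (weightProj_coe V H ν ⟨A w, hA w w.2⟩)

lemma res_mul (hB : ∀ w ∈ weightSubspace V H ν, B w ∈ weightSubspace V H ν) :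
    res V H ν (A * B) = res V H ν A * res V H ν B := by
  ext w
  rw [Module.End.mul_apply]
  change ((weightProj V H ν (A (B w)) : weightSubspace V H ν) : ⨂[ℂ] i, V i) =
    (weightProj V H ν (A (res V H ν B w)) : weightSubspace V H ν)
  rw [coe_res V hB]

lemma restrict_eq_res (hA : ∀ w ∈ weightSubspace V H ν, A w ∈ weightSubspace V H ν) :
    A.restrict hA = res V H ν A := by
  ext w
  rw [coe_res V hA]
  rfl

lemma expEnd_comp_subtype (hA : ∀ w ∈ weightSubspace V H ν, A w ∈ weightSubspace V H ν) :
    expEnd A ∘ₗ (weightSubspace V H ν).subtype =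
      (weightSubspace V H ν).subtype ∘ₗ expEnd (res V H ν A) :=
  expEnd_intertwine (LinearMap.ext fun w => (coe_res V hA w).symm)

lemma expEnd_mem (hA : ∀ w ∈ weightSubspace V H ν, A w ∈ weightSubspace V H ν) :
    ∀ w ∈ weightSubspace V H ν, expEnd A w ∈ weightSubspace V H ν := by
  intro w hw
  have := LinearMap.congr_fun (expEnd_comp_subtype V hA) ⟨w, hw⟩
  simp only [LinearMap.comp_apply, Submodule.subtype_apply] at this
  rw [this]
  exact Subtype.property _

lemma res_expEnd (hA : ∀ w ∈ weightSubspace V H ν, A w ∈ weightSubspace V H ν) :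
    res V H ν (expEnd A) = expEnd (res V H ν A) := by
  ext w
  rw [coe_res V (expEnd_mem V hA)]
  exact LinearMap.congr_fun (expEnd_comp_subtype V hA) w

end Res

variable {H : LieSubalgebra ℂ L} [H.IsCartanSubalgebra]

lemma totalAct_smul (c : ℂ) (y : L) : totalAct V (c • y) = c • totalAct V y := by
  simp only [totalAct, factorAct_smul, Finset.smul_sum]

lemma totalAct_lie (y z : L) :
    totalAct V ⁅y, z⁆ = totalAct V y * totalAct V z - totalAct V z * totalAct V y := by
  simp only [totalAct]
  rw [Finset.mul_sum, Finset.sum_mul, ← Finset.sum_sub_distrib]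
  refine Finset.sum_congr rfl fun k _ => ?_
  rw [eq_sub_iff_add_eq, add_comm]
  exact (totalAct_factorAct V k y z).symm

/-- An element of `L` of weight `μ` maps `V[ν]` to `V[ν + μ]`. -/
lemma totalAct_mem {ν μ : Dual ℂ H} {y : L} (hy : ∀ h : H, ⁅(h : L), y⁆ = μ h • y)
    {w : ⨂[ℂ] i, V i} (hw : w ∈ weightSubspace V H ν) :
    totalAct V y w ∈ weightSubspace V H (ν + μ) := by
  rw [mem_weightSubspace_iff] at hw ⊢
  intro h
  have h1 := totalAct_lie V (h : L) y
  rw [hy, totalAct_smul] at h1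
  have h2 := LinearMap.congr_fun h1 w
  simp only [LinearMap.smul_apply, LinearMap.sub_apply, Module.End.mul_apply, hw h, map_smul] at h2
  rw [← sub_eq_zero, LinearMap.add_apply, add_smul, h2]
  abel

lemma factorAct_mem (ν : Dual ℂ H) (k : Fin n) (h : H) :
    ∀ w ∈ weightSubspace V H ν, factorAct V k (h : L) w ∈ weightSubspace V H ν :=
  mapsTo_of_commute V fun h' => factorAct_cartan_commute V k h h'

lemma sum_factorAct_mem (ν : Dual ℂ H) (c : Fin n → ℂ) (h : H) :
    ∀ w ∈ weightSubspace V H ν, (∑ k, c k • factorAct V k (h : L)) w ∈ weightSubspace V H ν := by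
  intro w hw
  rw [LinearMap.sum_apply]
  exact Submodule.sum_mem _ fun k _ => Submodule.smul_mem _ _ (factorAct_mem V ν k h w hw)

lemma zPow_mem (ν : Dual ℂ H) (logz : Fin n → ℂ) (ω : H) :
    ∀ w ∈ weightSubspace V H ν, zPow V logz ω w ∈ weightSubspace V H ν :=
  expEnd_mem V (sum_factorAct_mem V ν logz ω)

lemma prod_Icc_one (f : ℕ → ℂ) (k : ℕ) :
    ∏ j ∈ Finset.Icc 1 k, f j = ∏ j ∈ Finset.range k, f (j + 1) := by
  induction k with
  | zero => simp
  | succ k ih => rw [Finset.prod_Icc_succ_top (by omega), ih, Finset.prod_range_succ]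

namespace RootData

variable (D : RootData H)

lemma Lam_eq (ν : Dual ℂ H) (k : Fin n) (lam : H) :
    Lam V D ν k lam = LinearMap.trace ℂ _ (res V H ν (factorAct V k (lam : L))) := by
  rw [Lam, restrict_eq_res]

lemma Lam_add_smul (ν : Dual ℂ H) (k : Fin n) (lam μ : H) (c : ℂ) :
    Lam V D ν k (lam + c • μ) = Lam V D ν k lam + c * Lam V D ν k μ := by
  have h : factorAct V k ((lam + c • μ : H) : L) =
      factorAct V k (lam : L) + c • factorAct V k (μ : L) := by
    have h1 := inFactor_sub V k (toEnd ℂ L (V k) ((lam + c • μ : H) : L))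
      (toEnd ℂ L (V k) ((c • μ : H) : L))
    rw [← map_sub] at h1
    have h2 : ((lam + c • μ : H) : L) - ((c • μ : H) : L) = (lam : L) :=
      congrArg Subtype.val (add_sub_cancel_right lam (c • μ))
    rw [h2] at h1
    rw [← factorAct_smul]
    exact (eq_add_of_sub_eq h1.symm)
  rw [Lam_eq, Lam_eq, Lam_eq, h, map_add, map_smul, map_add, map_smul, smul_eq_mul]

lemma det_res_zPow (ν : Dual ℂ H) (logz : Fin n → ℂ) (ω : H) :
    LinearMap.det (res V H ν (zPow V logz ω)) =
      Complex.exp (∑ k, logz k * Lam V D ν k ω) := by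
  rw [zPow, res_expEnd V (sum_factorAct_mem V ν logz ω), det_expEnd, map_sum, map_sum]
  simp only [map_smul, smul_eq_mul, Lam_eq]

lemma Lam_neg (ν : Dual ℂ H) (k : Fin n) (lam : H) :
    Lam V D ν k (-lam) = -Lam V D ν k lam := by
  have h0 := D.Lam_add_smul V ν k 0 0 1
  have h1 := D.Lam_add_smul V ν k 0 lam (-1)
  rw [one_smul, add_zero, one_mul, left_eq_add] at h0
  rw [h0, zero_add, zero_add, neg_smul, one_smul] at h1
  rw [h1]
  ring

/-! ### The `sl_2`-triple of a root -/

lemma coe_neg (α : H.root) :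
    (((D.neg α : H.root) : Weight ℂ H L) : H → ℂ) = -((α : Weight ℂ H L) : H → ℂ) :=
  funext fun h => LinearMap.congr_fun (D.rt_neg α) h

/-- By invariance of the form and `(e_α, e_{-α}) = 1`, the bracket of `e_α` and `e_{-α}` is `α`
under the identification of `H^*` with `H`. -/
lemma lie_e_neg (α : H.root) : ⁅D.e α, D.e (D.neg α)⁆ = (D.sharp (D.rt α) : L) := by
  have hmem : ⁅D.e α, D.e (D.neg α)⁆ ∈ H := by
    have h1 := LieAlgebra.lie_mem_genWeightSpace_of_mem_genWeightSpace (D.e_mem α)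
      (D.e_mem (D.neg α))
    have h2 : ⁅D.e α, D.e (D.neg α)⁆ ∈ LieAlgebra.rootSpace H (0 : H → ℂ) := by
      rwa [coe_neg, add_neg_cancel] at h1
    rwa [LieAlgebra.rootSpace_zero_eq, LieSubalgebra.mem_toLieSubmodule] at h2
  have key : D.flat ⟨_, hmem⟩ = D.flat (D.sharp (D.rt α)) := by
    rw [flat_sharp]
    ext h
    have h1 := D.form_invariant (D.e (D.neg α)) (D.e α) (h : L)
    have h2 : ⁅D.e (D.neg α), (h : L)⁆ = D.rt α h • D.e (D.neg α) := by
      rw [← lie_skew, lie_e, rt_neg]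
      simp
    have h3 : ⁅D.e (D.neg α), D.e α⁆ = -⁅D.e α, D.e (D.neg α)⁆ := (lie_skew _ _).symm
    rw [h3, h2, map_smul, smul_eq_mul] at h1
    have h4 := D.e_pair α
    change D.form (D.e α) (D.e (D.neg α)) = 1 at h4
    rw [h4, mul_one, map_neg, LinearMap.neg_apply, neg_inj] at h1
    exact h1
  have := D.flat_injective key
  rw [← this]

/-- The coroot is `2α/(α,α)` for the chosen form. The form is not compared with the Killing form:
the coroot is proportional to `⁅e_α, e_{-α}⁆`, and its pairing with `α` is `2`. -/
lemma corootVec_eq (α : H.root) :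
    D.dualForm (D.rt α) (D.rt α) ≠ 0 ∧
      D.corootVec α = (2 / D.dualForm (D.rt α) (D.rt α)) • D.sharp (D.rt α) := by
  obtain ⟨c, hc⟩ : ∃ c : ℂ, D.corootVec α = c • D.sharp (D.rt α) := by
    have h1 := D.lie_e_neg α
    have h2 : D.e (D.neg α) ∈ LieAlgebra.rootSpace H (-((α : Weight ℂ H L) : H → ℂ)) := by
      rw [← coe_neg]
      exact D.e_mem (D.neg α)
    rw [IsKilling.lie_eq_killingForm_smul_of_mem_rootSpace_of_mem_rootSpace_neg (D.e_mem α) h2]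
      at h1
    have h5 : D.sharp (D.rt α) = killingForm ℂ L (D.e α) (D.e (D.neg α)) •
        (IsKilling.cartanEquivDual H).symm (α : Weight ℂ H L) := Subtype.ext h1.symm
    have h6 : D.sharp (D.rt α) ≠ 0 := by
      intro h0
      have := D.flat_sharp (D.rt α)
      rw [h0, map_zero] at this
      exact (IsKilling.rootSystem H).ne_zero α this.symm
    have h7 : killingForm ℂ L (D.e α) (D.e (D.neg α)) ≠ 0 := by
      intro h0
      rw [h0, zero_smul] at h5
      exact h6 h5
    refine ⟨2 * ((α : Weight ℂ H L) ((IsKilling.cartanEquivDual H).symm (α : Weight ℂ H L)))⁻¹ *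
      (killingForm ℂ L (D.e α) (D.e (D.neg α)))⁻¹, ?_⟩
    rw [h5, smul_smul, mul_assoc, inv_mul_cancel₀ h7, mul_one, mul_smul]
    rw [corootVec, IsKilling.rootSystem_coroot_apply, IsKilling.coroot, two_nsmul, two_smul]
  have h2 := D.rt_corootVec_self α
  rw [hc, map_smul, smul_eq_mul] at h2
  change c * D.dualForm (D.rt α) (D.rt α) = 2 at h2
  have hne : D.dualForm (D.rt α) (D.rt α) ≠ 0 := by
    intro h0
    rw [h0, mul_zero] at h2
    exact two_ne_zero h2.symm
  exact ⟨hne, by rw [hc, ← h2, mul_div_cancel_right₀ _ hne]⟩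

lemma isTriple (α : H.root) :
    IsTriple (D.EOp V α) (D.FOp V α) (totalAct V (D.corootVec α : L)) := by
  obtain ⟨-, hc⟩ := D.corootVec_eq α
  refine ⟨fun x => ?_, fun x => ?_, fun x => ?_⟩
  · have h1 := totalAct_lie V ((2 / D.dualForm (D.rt α) (D.rt α)) • D.e α) (D.e (D.neg α))
    have h3 : (2 / D.dualForm (D.rt α) (D.rt α)) • (D.sharp (D.rt α) : L) = D.corootVec α := by
      rw [hc]
      rfl
    rw [smul_lie, lie_e_neg, h3] at h1
    have h2 := LinearMap.congr_fun h1 x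
    simp only [LinearMap.sub_apply, Module.End.mul_apply] at h2
    rw [h2, EOp, FOp]
    abel
  · have h1 := totalAct_lie V (D.corootVec α : L) ((2 / D.dualForm (D.rt α) (D.rt α)) • D.e α)
    rw [lie_smul, lie_e, rt_corootVec_self, smul_comm, totalAct_smul] at h1
    have h2 := LinearMap.congr_fun h1 x
    simp only [LinearMap.sub_apply, Module.End.mul_apply, LinearMap.smul_apply] at h2
    rw [EOp, h2]
    abel
  · have h1 := totalAct_lie V (D.corootVec α : L) (D.e (D.neg α))
    rw [lie_e, rt_neg, LinearMap.neg_apply, rt_corootVec_self, totalAct_smul] at h1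
    have h2 := LinearMap.congr_fun h1 x
    simp only [LinearMap.sub_apply, Module.End.mul_apply, LinearMap.smul_apply] at h2
    rw [FOp, eq_add_of_sub_eq h2.symm]
    module

lemma EOp_mem {ν : Dual ℂ H} (α : H.root) {w : ⨂[ℂ] i, V i} (hw : w ∈ weightSubspace V H ν) :
    D.EOp V α w ∈ weightSubspace V H (ν + D.rt α) :=
  totalAct_mem V (fun h => by rw [lie_smul, lie_e, smul_comm]) hw

lemma FOp_EOp_mem {ν : Dual ℂ H} (α : H.root) {w : ⨂[ℂ] i, V i}
    (hw : w ∈ weightSubspace V H ν) : D.FOp V α (D.EOp V α w) ∈ weightSubspace V H ν := by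
  have h1 : D.FOp V α (D.EOp V α w) ∈ weightSubspace V H (ν + D.rt α + D.rt (D.neg α)) :=
    totalAct_mem V (fun h => D.lie_e h (D.neg α)) (D.EOp_mem V α hw)
  rwa [rt_neg, add_neg_cancel_right] at h1

lemma EOp_pow_mem {ν : Dual ℂ H} (α : H.root) {w : ⨂[ℂ] i, V i}
    (hw : w ∈ weightSubspace V H ν) (k : ℕ) :
    (D.EOp V α ^ k) w ∈ weightSubspace V H (ν + k • D.rt α) := by
  induction k with
  | zero => simpa using hw
  | succ k ih =>
    rw [pow_succ', Module.End.mul_apply, succ_nsmul, ← add_assoc]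
    exact D.EOp_mem V α ih

/-- The multiplicities of the irreducible `sl_2`-modules in `V[ν]_α`. -/
lemma mult_eq (ν : Dual ℂ H) (α : H.root) (k : ℕ) :
    D.mult V ν α k = finrank ℂ (IsTriple.kerPow (D.EOp V α) (weightSubspace V H ν) (k + 1)) -
      finrank ℂ (IsTriple.kerPow (D.EOp V α) (weightSubspace V H ν) k) := by
  refine (D.isTriple V α).finrank_highest (h := ν (D.corootVec α)) (fun w hw => ?_)
    (fun w hw => D.FOp_EOp_mem V α hw) ?_ ?_ ?_ k ?_ ?_
  · exact (mem_weightSubspace_iff V ν w).1 hw _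
  · exact le_sInf fun W hW => hW.1
  · intro w hw
    rw [sl2Span, Submodule.mem_sInf] at hw ⊢
    exact fun W hW => hW.2.1 w (hw W hW)
  · exact fun U' h1 h2 h3 h4 => sInf_le ⟨h1, h2, h3, h4⟩
  · intro x hx
    rw [(mem_weightSubspace_iff V _ x).1 hx]
    congr 1
    simp only [LinearMap.add_apply, LinearMap.smul_apply, rt_corootVec_self, nsmul_eq_mul]
    ring
  · exact fun w hw => D.EOp_pow_mem V α hw k

lemma mult_eq_zero (ν : Dual ℂ H) (α : H.root) {N : ℕ} (hN : D.EOp V α ^ N = 0) {k : ℕ}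
    (hk : N ≤ k) : D.mult V ν α k = 0 := by
  have h : ∀ j, N ≤ j → IsTriple.kerPow (D.EOp V α) (weightSubspace V H ν) j = ⊤ := by
    intro j hj
    rw [IsTriple.kerPow, pow_eq_zero_of_le hj hN, LinearMap.zero_comp, LinearMap.ker_zero]
  rw [mult_eq, h k hk, h (k + 1) (by omega), Nat.sub_self]

/-- The determinant of `𝔹_V^α(λ)` on `V[ν]`, as a function of `s = (λ, α)`. -/
def bDet (ν : Dual ℂ H) (α : H.root) (s : ℂ) : ℂ :=
  ∏ᶠ k : ℕ, (∏ j ∈ Finset.Icc 1 k, (s + D.halfShift ν α j) / (s - D.halfShift ν α j)) ^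
    D.mult V ν α k

lemma finprod_pow_mult (ν : Dual ℂ H) (α : H.root) {N : ℕ} (hN : D.EOp V α ^ N = 0) (f : ℕ → ℂ) :
    ∏ᶠ k, f k ^ D.mult V ν α k = ∏ k ∈ Finset.range N, f k ^ D.mult V ν α k := by
  refine finprod_eq_prod_of_mulSupport_subset _ fun k hk => ?_
  by_contra hlt
  rw [Finset.coe_range, Set.mem_Iio, not_lt] at hlt
  exact hk (by simp only [D.mult_eq_zero V ν α hN hlt, pow_zero])

/-- Since `E_α` is nilpotent, the sum defining `𝔹_V^α` is finite. -/
lemma BOp_eq_sum (ν : Dual ℂ H) (α : H.root) (lam : H) {N : ℕ} (hN : D.EOp V α ^ N = 0) :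
    D.BOp V ν α lam = ∑ m ∈ Finset.range N, ((1 / (m.factorial : ℂ)) *
      ∏ j ∈ Finset.range m,
        ((D.pairCoroot lam α + ν (D.corootVec α) / 2 - 1) - ν (D.corootVec α) - j)⁻¹) •
          (D.FOp V α ^ m * D.EOp V α ^ m) := by
  refine finsum_eq_sum_of_support_subset _ fun m hm => ?_
  by_contra hlt
  rw [Finset.coe_range, Set.mem_Iio, not_lt] at hlt
  exact hm (by simp only [pow_eq_zero_of_le hlt hN, mul_zero, smul_zero])

lemma BOp_mem (ν : Dual ℂ H) (α : H.root) (lam : H) :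
    ∀ w ∈ weightSubspace V H ν, D.BOp V ν α lam w ∈ weightSubspace V H ν := by
  intro w hw
  obtain ⟨N, hN⟩ := (D.isTriple V α).exists_pow_e_eq_zero
  rw [D.BOp_eq_sum V ν α lam hN, LinearMap.sum_apply]
  refine Submodule.sum_mem _ fun m _ => Submodule.smul_mem _ _ ?_
  exact (D.isTriple V α).pow_fe_mem (fun w hw => (mem_weightSubspace_iff V ν w).1 hw _)
    (fun w hw => D.FOp_EOp_mem V α hw) hw m

lemma halfShift_eq (ν : Dual ℂ H) (α : H.root) (j : ℕ) :
    D.halfShift ν α j =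
      D.dualForm (D.rt α) (D.rt α) / 2 * (ν (D.corootVec α) / 2 + j) := by
  obtain ⟨hne, hc⟩ := D.corootVec_eq α
  have h1 : ν (D.corootVec α) = 2 / D.dualForm (D.rt α) (D.rt α) * ν (D.sharp (D.rt α)) := by
    rw [hc, map_smul, smul_eq_mul]
  have h2 : D.dualForm (ν + j • D.rt α) (D.rt α) =
      ν (D.sharp (D.rt α)) + j * D.dualForm (D.rt α) (D.rt α) := by
    simp [dualForm]
  rw [halfShift, h1, h2]
  field_simp

lemma det_res_BOp (ν : Dual ℂ H) (α : H.root) (lam : H)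
    (hreg : ∀ k, D.mult V ν α k ≠ 0 → ∀ j ∈ Finset.Icc 1 k, D.rt α lam ≠ D.halfShift ν α j) :
    LinearMap.det (res V H ν (D.BOp V ν α lam)) = D.bDet V ν α (D.rt α lam) := by
  obtain ⟨N, hN⟩ := (D.isTriple V α).exists_pow_e_eq_zero
  obtain ⟨hne, -⟩ := D.corootVec_eq α
  rw [bDet, D.finprod_pow_mult V ν α hN]
  rw [(D.isTriple V α).det_eq (h := ν (D.corootVec α))
    (fun w hw => (mem_weightSubspace_iff V ν w).1 hw _)
    (fun w hw => D.FOp_EOp_mem V α hw) hN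
    (fun m => (1 / (m.factorial : ℂ)) * ∏ j ∈ Finset.range m,
        ((D.pairCoroot lam α + ν (D.corootVec α) / 2 - 1) - ν (D.corootVec α) - j)⁻¹) N]
  · refine Finset.prod_congr rfl fun k hk => ?_
    rw [← mult_eq]
    by_cases hm : D.mult V ν α k = 0
    · rw [hm, pow_zero, pow_zero]
    congr 1
    have hden : ∀ j : ℕ,
        (D.pairCoroot lam α + ν (D.corootVec α) / 2 - 1) - ν (D.corootVec α) - j =
          2 / D.dualForm (D.rt α) (D.rt α) * (D.rt α lam - D.halfShift ν α (j + 1)) := by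
      intro j
      rw [halfShift_eq, pairCoroot]
      field_simp
      push_cast
      ring
    rw [sum_feValue _ _ _ _ (Finset.mem_range.1 hk)]
    · rw [prod_Icc_one]
      refine Finset.prod_congr rfl fun j _ => ?_
      have hnum : D.pairCoroot lam α + ν (D.corootVec α) / 2 - 1 - ν (D.corootVec α) +
          ν (D.corootVec α) + 2 + j =
            2 / D.dualForm (D.rt α) (D.rt α) * (D.rt α lam + D.halfShift ν α (j + 1)) := by
        rw [halfShift_eq, pairCoroot]
        field_simp
        push_cast
        ring
      rw [hden, hnum, mul_div_mul_left _ _ (div_ne_zero two_ne_zero hne)]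
    · intro j hj
      rw [hden]
      refine mul_ne_zero (div_ne_zero two_ne_zero hne) (sub_ne_zero.2 (hreg k hm _ ?_))
      rw [Finset.mem_Icc]
      omega
  · intro w
    rw [coe_res V (D.BOp_mem V ν α lam), D.BOp_eq_sum V ν α lam hN, LinearMap.sum_apply]
    rfl

/-! ### Determinants of the dynamical operators and the functional equation of `X` -/

/-- The conjugation by `∏ z_k^{ω^{(k)}}` does not change the determinant, and `(λ - κω, α)` is
`(λ, α) + κ j` when `(ω, α) = -j`. -/
lemma det_res_GOp (ν : Dual ℂ H) (κ : ℂ) (logz : Fin n → ℂ) (lam : H) (a : D.AffRoot)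
    (hreg : ∀ k, D.mult V ν a.1 k ≠ 0 → ∀ j ∈ Finset.Icc 1 k,
      D.rt a.1 lam + κ * a.2 ≠ D.halfShift ν a.1 j) :
    LinearMap.det (res V H ν (D.GOp V ν κ logz lam a)) =
      D.bDet V ν a.1 (D.rt a.1 lam + κ * a.2) := by
  have hs : D.rt a.1 (lam - κ • D.shift a.1 a.2) = D.rt a.1 lam + κ * a.2 := by
    have h1 : D.rt a.1 (D.shift a.1 a.2) = -(a.2 : ℂ) := (D.exists_shift a.1 a.2).choose_spec.2
    rw [map_sub, map_smul, h1, smul_eq_mul]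
    ring
  rw [GOp, res_mul V (zPow_mem V ν logz _), res_mul V (D.BOp_mem V ν _ _), map_mul, map_mul,
    D.det_res_BOp V ν a.1 _ (by rwa [hs]), hs, D.det_res_zPow V ν, D.det_res_zPow V ν, mul_right_comm,
    ← Complex.exp_add]
  simp [Lam_neg]

lemma GOp_mem (ν : Dual ℂ H) (κ : ℂ) (logz : Fin n → ℂ) (lam : H) (a : D.AffRoot) :
    ∀ w ∈ weightSubspace V H ν, D.GOp V ν κ logz lam a w ∈ weightSubspace V H ν := by
  intro w hw
  rw [GOp, Module.End.mul_apply, Module.End.mul_apply]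
  exact zPow_mem V ν logz _ _ (D.BOp_mem V ν _ _ _ (zPow_mem V ν logz _ _ hw))

lemma list_prod_mem_and_det (ν : Dual ℂ H) {ι : Type*} (l : List ι)
    (G : ι → End ℂ (⨂[ℂ] i, V i))
    (hG : ∀ a ∈ l, ∀ w ∈ weightSubspace V H ν, G a w ∈ weightSubspace V H ν) :
    (∀ w ∈ weightSubspace V H ν, (l.map G).reverse.prod w ∈ weightSubspace V H ν) ∧
      LinearMap.det (res V H ν (l.map G).reverse.prod) =
        (l.map fun a => LinearMap.det (res V H ν (G a))).prod := by
  induction l with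
  | nil =>
    refine ⟨fun w hw => by simpa using hw, ?_⟩
    have : res V H ν (1 : End ℂ (⨂[ℂ] i, V i)) = LinearMap.id :=
      LinearMap.ext fun w => weightProj_coe V H ν w
    simp [this]
  | cons a l ih =>
    obtain ⟨h1, h2⟩ := ih fun b hb => hG b (List.mem_cons_of_mem _ hb)
    have ha := hG a List.mem_cons_self
    rw [List.map_cons, List.reverse_cons, List.prod_append, List.prod_singleton, List.map_cons,
      List.prod_cons, res_mul V ha, map_mul, h2, mul_comm]
    exact ⟨fun w hw => h1 _ (ha w hw), rfl⟩

lemma GWord_mem (ν : Dual ℂ H) (κ : ℂ) (logz : Fin n → ℂ) (lam : H)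
    (js : List (Option D.base.support)) :
    ∀ w ∈ weightSubspace V H ν, D.GWord V ν κ logz lam js w ∈ weightSubspace V H ν :=
  (list_prod_mem_and_det V ν _ _ fun a _ => D.GOp_mem V ν κ logz lam a).1

lemma IsRegular.ne {D : RootData H} {ν : Dual ℂ H} {κ : ℂ} {lam : H} (h : D.IsRegular V ν κ lam)
    {α : H.root} (hα : D.base.IsPos α) {k : ℕ} (hk : D.mult V ν α k ≠ 0) {j : ℕ}
    (hj : j ∈ Finset.Icc 1 k) (m : ℤ) : D.rt α lam - D.halfShift ν α j ≠ m * κ :=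
  h α (D.mem_posRoots.2 hα) k hk j hj m

lemma det_res_GWord (ν : Dual ℂ H) (κ : ℂ) (logz : Fin n → ℂ) {lam : H}
    (hreg : D.IsRegular V ν κ lam) {i : D.base.support} {js : List (Option D.base.support)}
    (h : D.IsReducedPresentation (D.fundCoweight i) js) :
    LinearMap.det (res V H ν (D.GWord V ν κ logz lam js)) =
      ∏ α ∈ D.posRoots, ∏ j ∈ Finset.range (D.level i α),
        D.bDet V ν α (D.rt α lam + κ * j) := by
  have h1 := h.prod_wordRoots fun a => D.bDet V ν a.1 (D.rt a.1 lam + κ * a.2)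
  simp only [Int.cast_natCast] at h1
  rw [GWord, (list_prod_mem_and_det V ν _ _ fun a _ => D.GOp_mem V ν κ logz lam a).2, ← h1]
  congr 1
  refine List.map_congr_left fun a ha => ?_
  refine D.det_res_GOp V ν κ logz lam a fun k hk j hj he => ?_
  refine hreg.ne V ((h.mem_wordRoots a).1 ha).1 hk hj (-a.2) ?_
  rw [← he]
  push_cast
  ring

/-- One factor of the functional equation of `X`. At a pole of the Gamma function in the
denominator both sides vanish, since `Complex.Gamma` takes the value `0` at its poles. -/
lemma gamma_div_step {κ s h : ℂ} (hκ : κ ≠ 0) (hs : s - h ≠ 0) :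
    Complex.Gamma (1 - (s + κ - h) / κ) / Complex.Gamma (1 - (s + κ + h) / κ) =
      (s + h) / (s - h) * (Complex.Gamma (1 - (s - h) / κ) / Complex.Gamma (1 - (s + h) / κ)) := by
  have h1 : 1 - (s + κ - h) / κ = -((s - h) / κ) := by field_simp; ring
  have h2 : 1 - (s + κ + h) / κ = -((s + h) / κ) := by field_simp; ring
  have h3 : Complex.Gamma (1 - (s - h) / κ) =
      -((s - h) / κ) * Complex.Gamma (-((s - h) / κ)) := by
    rw [← Complex.Gamma_add_one _ (neg_ne_zero.2 (div_ne_zero hs hκ))]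
    congr 1
    ring
  have h4 := Complex.one_div_Gamma_eq_self_mul_one_div_Gamma_add_one (-((s + h) / κ))
  rw [show -((s + h) / κ) + 1 = 1 - (s + h) / κ by ring] at h4
  rw [h1, h2, h3, div_eq_mul_inv, div_eq_mul_inv (-((s - h) / κ) * _), h4]
  field_simp

/-- `X_{α,V[ν]}` as a function of `s = (λ, α)`. -/
def XFun (ν : Dual ℂ H) (κ : ℂ) (α : H.root) (s : ℂ) : ℂ :=
  ∏ᶠ k : ℕ, (∏ j ∈ Finset.Icc 1 k,
    Complex.Gamma (1 - (s - D.halfShift ν α j) / κ) /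
      Complex.Gamma (1 - (s + D.halfShift ν α j) / κ)) ^ D.mult V ν α k

lemma XFun_step (ν : Dual ℂ H) {κ : ℂ} (hκ : κ ≠ 0) (α : H.root) (s : ℂ)
    (hs : ∀ k, D.mult V ν α k ≠ 0 → ∀ j ∈ Finset.Icc 1 k, s ≠ D.halfShift ν α j) :
    D.XFun V ν κ α (s + κ) = D.bDet V ν α s * D.XFun V ν κ α s := by
  obtain ⟨N, hN⟩ := (D.isTriple V α).exists_pow_e_eq_zero
  rw [XFun, XFun, bDet, D.finprod_pow_mult V ν α hN, D.finprod_pow_mult V ν α hN,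
    D.finprod_pow_mult V ν α hN, ← Finset.prod_mul_distrib]
  refine Finset.prod_congr rfl fun k _ => ?_
  by_cases hm : D.mult V ν α k = 0
  · simp [hm]
  · rw [← mul_pow, ← Finset.prod_mul_distrib]
    congr 1
    exact Finset.prod_congr rfl fun j hj => gamma_div_step hκ (sub_ne_zero.2 (hs k hm j hj))

lemma XFun_shift (ν : Dual ℂ H) {κ : ℂ} (hκ : κ ≠ 0) (α : H.root) (s : ℂ)
    (hs : ∀ k, D.mult V ν α k ≠ 0 → ∀ j ∈ Finset.Icc 1 k, ∀ m : ℤ,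
      s - D.halfShift ν α j ≠ m * κ) (m : ℕ) :
    D.XFun V ν κ α (s + κ * m) =
      (∏ i ∈ Finset.range m, D.bDet V ν α (s + κ * i)) * D.XFun V ν κ α s := by
  induction m with
  | zero => simp
  | succ m ih =>
    have h1 : s + κ * ((m + 1 : ℕ) : ℂ) = s + κ * m + κ := by
      push_cast
      ring
    rw [h1, D.XFun_step V ν hκ α (s + κ * m), ih, Finset.prod_range_succ]
    · ring
    · intro k hk j hj he
      refine hs k hk j hj (-m) ?_
      rw [← he]
      push_cast
      ring

/-- Far away in the antidominant direction `X` does not vanish. -/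
lemma eventually_XFun_ne_zero (ν : Dual ℂ H) {κ : ℂ} (hκ : κ ≠ 0) (α : H.root) (s : ℂ)
    (hs : ∀ k, D.mult V ν α k ≠ 0 → ∀ j ∈ Finset.Icc 1 k, ∀ m : ℤ,
      s - D.halfShift ν α j ≠ m * κ) :
    ∀ᶠ m : ℕ in Filter.atTop, D.XFun V ν κ α (s - κ * m) ≠ 0 := by
  obtain ⟨N, hN⟩ := (D.isTriple V α).exists_pow_e_eq_zero
  have h1 : ∀ᶠ m : ℕ in Filter.atTop, ∀ j ∈ Finset.range N,
      -(1 - (s + D.halfShift ν α j) / κ).re < m := by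
    rw [Filter.eventually_all_finset]
    exact fun j _ => (tendsto_natCast_atTop_atTop (R := ℝ)).eventually_gt_atTop _
  filter_upwards [h1] with m hm
  rw [XFun, D.finprod_pow_mult V ν α hN, Finset.prod_ne_zero_iff]
  intro k hk
  by_cases hmk : D.mult V ν α k = 0
  · simp [hmk]
  refine pow_ne_zero _ (Finset.prod_ne_zero_iff.2 fun j hj => div_ne_zero ?_ ?_)
  · refine Complex.Gamma_ne_zero fun i he => hs k hmk j hj (m + i + 1) ?_
    have h2 : (s - κ * m - D.halfShift ν α j) / κ = i + 1 := by
      rw [sub_eq_iff_eq_add] at he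
      linear_combination -he
    rw [div_eq_iff hκ] at h2
    push_cast
    linear_combination h2
  · have hjN : j ∈ Finset.range N := by
      rw [Finset.mem_range] at hk ⊢
      have := (Finset.mem_Icc.1 hj).2
      omega
    refine Complex.Gamma_ne_zero_of_re_pos ?_
    have h2 : 1 - (s - κ * m + D.halfShift ν α j) / κ = 1 - (s + D.halfShift ν α j) / κ + m := by
      field_simp
      ring
    rw [h2, Complex.add_re, Complex.natCast_re]
    linarith [hm j hjN]

lemma prod_X_shift (ν : Dual ℂ H) {κ : ℂ} (hκ : κ ≠ 0) {lam : H} (hreg : D.IsRegular V ν κ lam)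
    (i : D.base.support) :
    ∏ α ∈ D.posRoots, D.X V ν κ α (lam + κ • D.fundCoweight i) =
      (∏ α ∈ D.posRoots, ∏ j ∈ Finset.range (D.level i α), D.bDet V ν α (D.rt α lam + κ * j)) *
        ∏ α ∈ D.posRoots, D.X V ν κ α lam := by
  rw [← Finset.prod_mul_distrib]
  refine Finset.prod_congr rfl fun α hα => ?_
  have h1 : D.rt α (lam + κ • D.fundCoweight i) = D.rt α lam + κ * D.level i α := by
    rw [map_add, map_smul, D.rt_fundCoweight_eq_level i (D.mem_posRoots.1 hα), smul_eq_mul]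
  change D.XFun V ν κ α _ = _ * D.XFun V ν κ α (D.rt α lam)
  rw [h1]
  exact D.XFun_shift V ν hκ α _ (hreg α hα) _

/-- Some point `λ - κ N ρ^∨`, for every sufficiently large `N`, is not a zero of `∏_α X_α`. -/
lemma eventually_prod_X_ne_zero (ν : Dual ℂ H) {κ : ℂ} (hκ : κ ≠ 0) {lam : H}
    (hreg : D.IsRegular V ν κ lam) :
    ∀ᶠ m : ℕ in Filter.atTop,
      ∏ α ∈ D.posRoots, D.X V ν κ α (lam - κ • m • D.rhoVec) ≠ 0 := by
  simp only [Finset.prod_ne_zero_iff]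
  rw [Filter.eventually_all_finset]
  intro α hα
  have hpos : 0 < D.base.height α := D.mem_posRoots.1 hα
  have hlim : Filter.Tendsto (fun m : ℕ => m * (D.base.height α).toNat) Filter.atTop
      Filter.atTop :=
    Filter.tendsto_atTop_mono (fun m => Nat.le_mul_of_pos_right m (by omega)) Filter.tendsto_id
  filter_upwards [hlim.eventually (D.eventually_XFun_ne_zero V ν hκ α _ (hreg α hα))] with m hm
  have h1 : D.rt α (lam - κ • m • D.rhoVec) =
      D.rt α lam - κ * ((m * (D.base.height α).toNat : ℕ) : ℂ) := by
    have h2 : (((D.base.height α).toNat : ℤ) : ℂ) = D.base.height α := by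
      rw [Int.toNat_of_nonneg hpos.le]
    rw [map_sub, map_smul, map_nsmul, rt_rhoVec, ← h2]
    push_cast
    rw [smul_eq_mul, nsmul_eq_mul]
  change D.XFun V ν κ α _ ≠ 0
  rwa [h1]

/-! ### Traces of the KZ operators -/

lemma omegaZero_mem (ν : Dual ℂ H) (k l : Fin n) :
    ∀ w ∈ weightSubspace V H ν, D.omegaZero V k l w ∈ weightSubspace V H ν := by
  intro w hw
  rw [omegaZero, LinearMap.smul_apply, LinearMap.sum_apply]
  refine Submodule.smul_mem _ _ (Submodule.sum_mem _ fun i _ => ?_)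
  rw [Module.End.mul_apply]
  exact factorAct_mem V ν k _ _ (factorAct_mem V ν l _ _ hw)

lemma lie_e_neg_root (h : H) (α : H.root) :
    ⁅(h : L), D.e (D.neg α)⁆ = (-(D.rt α h)) • D.e (D.neg α) := by
  rw [lie_e, rt_neg]
  rfl

lemma pair_mem (ν : Dual ℂ H) (k l : Fin n) (α : H.root) :
    ∀ w ∈ weightSubspace V H ν,
      (factorAct V k (D.e α) * factorAct V l (D.e (D.neg α))) w ∈ weightSubspace V H ν :=
  mapsTo_of_commute V fun h =>
    totalAct_pair_commute V k l h (D.lie_e h α) (D.lie_e_neg_root h α)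

lemma omegaPlus_mem (ν : Dual ℂ H) (k l : Fin n) :
    ∀ w ∈ weightSubspace V H ν, D.omegaPlus V k l w ∈ weightSubspace V H ν := by
  intro w hw
  rw [omegaPlus, LinearMap.add_apply, LinearMap.sum_apply]
  exact add_mem (D.omegaZero_mem V ν k l w hw)
    (Submodule.sum_mem _ fun α _ => D.pair_mem V ν k l α w hw)

lemma omegaMinus_eq (k l : Fin n) :
    D.omegaMinus V k l = D.omegaZero V k l +
      ∑ α ∈ D.posRoots, factorAct V k (D.e (D.neg α)) *
        factorAct V l (D.e (D.neg (D.neg α))) := by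
  simp only [omegaMinus, neg_neg_root]

lemma omegaMinus_mem (ν : Dual ℂ H) (k l : Fin n) :
    ∀ w ∈ weightSubspace V H ν, D.omegaMinus V k l w ∈ weightSubspace V H ν := by
  intro w hw
  rw [omegaMinus_eq, LinearMap.add_apply, LinearMap.sum_apply]
  exact add_mem (D.omegaZero_mem V ν k l w hw)
    (Submodule.sum_mem _ fun α _ => D.pair_mem V ν k l (D.neg α) w hw)

/-- The operator `e_α^{(k)} e_{-α}^{(l)}` has trace zero: it is a multiple of its commutator with
`h^{(k)}`. -/
lemma trace_pair (ν : Dual ℂ H) {k l : Fin n} (hkl : k ≠ l) (α : H.root) :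
    LinearMap.trace ℂ _
      (res V H ν (factorAct V k (D.e α) * factorAct V l (D.e (D.neg α)))) = 0 := by
  have h1 := factorAct_lie V k (D.corootVec α : L) (D.e α)
  rw [lie_e, rt_corootVec_self, factorAct_smul] at h1
  have h2 : (2 : ℂ) • (factorAct V k (D.e α) * factorAct V l (D.e (D.neg α))) =
      factorAct V k (D.corootVec α : L) *
        (factorAct V k (D.e α) * factorAct V l (D.e (D.neg α))) -
      (factorAct V k (D.e α) * factorAct V l (D.e (D.neg α))) *
        factorAct V k (D.corootVec α : L) := by
    have hc : factorAct V l (D.e (D.neg α)) * factorAct V k (D.corootVec α : L) =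
        factorAct V k (D.corootVec α : L) * factorAct V l (D.e (D.neg α)) :=
      inFactor_comm V hkl.symm _ _
    rw [← smul_mul_assoc, h1, sub_mul, mul_assoc, mul_assoc, mul_assoc, hc]
  have h3 := congrArg (fun A => LinearMap.trace ℂ _ (res V H ν A)) h2
  simp only [map_smul, map_sub] at h3
  rw [res_mul V (D.pair_mem V ν k l α), res_mul V (factorAct_mem V ν k _),
    LinearMap.trace_mul_comm, sub_self, smul_eq_zero] at h3
  exact h3.resolve_left two_ne_zero

lemma eps_eq (ν : Dual ℂ H) (k l : Fin n) :
    D.eps V ν k l = LinearMap.trace ℂ _ (res V H ν (D.omega V k l)) := by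
  rw [eps, restrict_eq_res]

lemma trace_omega (ν : Dual ℂ H) {k l : Fin n} (hkl : k ≠ l) :
    LinearMap.trace ℂ _ (res V H ν (D.omegaPlus V k l)) = D.eps V ν k l / 2 ∧
      LinearMap.trace ℂ _ (res V H ν (D.omegaMinus V k l)) = D.eps V ν k l / 2 := by
  have h1 : LinearMap.trace ℂ _ (res V H ν (D.omegaPlus V k l)) =
      LinearMap.trace ℂ _ (res V H ν (D.omegaZero V k l)) := by
    rw [omegaPlus, map_add, map_add, map_sum, map_sum,
      Finset.sum_eq_zero fun α _ => D.trace_pair V ν hkl α, add_zero]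
  have h2 : LinearMap.trace ℂ _ (res V H ν (D.omegaMinus V k l)) =
      LinearMap.trace ℂ _ (res V H ν (D.omegaZero V k l)) := by
    rw [omegaMinus_eq, map_add, map_add, map_sum, map_sum,
      Finset.sum_eq_zero fun α _ => D.trace_pair V ν hkl (D.neg α), add_zero]
  rw [eps_eq, omega, map_add, map_add, h1, h2]
  constructor <;> ring

/-- `Ω` is a symmetric tensor. -/
lemma eps_symm (ν : Dual ℂ H) {k l : Fin n} (hkl : k ≠ l) : D.eps V ν k l = D.eps V ν l k := by
  have hz : D.omegaZero V k l = D.omegaZero V l k := by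
    rw [omegaZero, omegaZero]
    congr 1
    exact Finset.sum_congr rfl fun i _ => inFactor_comm V hkl _ _
  have hp : ∀ {k l : Fin n}, k ≠ l → D.omegaZero V k l = D.omegaZero V l k →
      D.omegaPlus V k l = D.omegaMinus V l k := by
    intro k l hkl hz
    rw [omegaPlus, omegaMinus, hz]
    congr 1
    exact Finset.sum_congr rfl fun i _ => inFactor_comm V hkl _ _
  rw [eps_eq, eps_eq, omega, omega, hp hkl hz, ← hp hkl.symm hz.symm, add_comm]

/-- The right-hand side of the `k`-th KZ equation, as an operator. -/
def kzOp (x : Fin n → ℂ) (lam : H) (k : Fin n) : End ℂ (⨂[ℂ] i, V i) :=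
  (∑ l ∈ Finset.univ.filter (· ≠ k), D.rMatrix V k l (x k / x l)) + factorAct V k (lam : L)

lemma kzOp_mem (ν : Dual ℂ H) (x : Fin n → ℂ) (lam : H) (k : Fin n) :
    ∀ w ∈ weightSubspace V H ν, D.kzOp V x lam k w ∈ weightSubspace V H ν := by
  intro w hw
  rw [kzOp, LinearMap.add_apply, LinearMap.sum_apply]
  refine add_mem (Submodule.sum_mem _ fun l _ => ?_) (factorAct_mem V ν k lam w hw)
  rw [rMatrix, LinearMap.smul_apply, LinearMap.add_apply, LinearMap.smul_apply]
  exact Submodule.smul_mem _ _ (add_mem (Submodule.smul_mem _ _ (D.omegaPlus_mem V ν k l w hw))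
    (D.omegaMinus_mem V ν k l w hw))

lemma trace_kzOp (ν : Dual ℂ H) {x : Fin n → ℂ} (hx : ∀ k, x k ≠ 0)
    (hx' : ∀ k l, k ≠ l → x k ≠ x l) (lam : H) (k : Fin n) :
    LinearMap.trace ℂ _ (res V H ν (D.kzOp V x lam k)) =
      x k * ∑ l ∈ Finset.univ.filter (· ≠ k), D.eps V ν k l / (x k - x l) -
        D.gam V ν k / 2 + Lam V D ν k lam := by
  rw [kzOp, map_add, map_add, map_sum, map_sum, ← Lam_eq, gam, Finset.sum_div, Finset.mul_sum,
    ← Finset.sum_sub_distrib]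
  congr 1
  refine Finset.sum_congr rfl fun l hl => ?_
  have hkl : k ≠ l := (Finset.mem_filter.1 hl).2.symm
  obtain ⟨h1, h2⟩ := D.trace_omega V ν hkl
  rw [rMatrix, map_smul, map_smul, map_add, map_add, map_smul, map_smul, h1, h2, smul_eq_mul,
    smul_eq_mul]
  have h3 := hx l
  have h4 : x k - x l ≠ 0 := sub_ne_zero.2 (hx' k l hkl)
  have h5 : x k / x l - 1 = (x k - x l) / x l := by field_simp
  rw [h5]
  field_simp
  ring

/-- The exponent of the `z`-dependent part of `D_{V[ν]}`. -/
def zExponent (ν : Dual ℂ H) (κ : ℂ) (logz : Fin n → ℂ) (logd : Fin n → Fin n → ℂ) (lam : H) : ℂ :=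
  (∑ k, logz k * (Lam V D ν k lam / κ - D.gam V ν k / (2 * κ))) +
    ∑ k, ∑ l ∈ Finset.univ.filter (k < ·), logd k l * (D.eps V ν k l / κ)

lemma detFun_eq (ν : Dual ℂ H) (κ : ℂ) (logz : Fin n → ℂ) (logd : Fin n → Fin n → ℂ) (lam : H) :
    D.detFun V ν κ logz logd lam = Complex.exp (D.zExponent V ν κ logz logd lam) *
      ∏ α ∈ D.posRoots, D.X V ν κ α lam := by
  simp only [detFun, zExponent, Complex.exp_add, Complex.exp_sum]

variable {Y : Type*} [TopologicalSpace Y] {p : Y → Fin n → ℂ}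

lemma hasDerivAt_zExponent (ν : Dual ℂ H) {κ : ℂ} (hκ : κ ≠ 0)
    {logz : Y → Fin n → ℂ} (hlogz : Continuous logz)
    (hlogz_exp : ∀ y k, Complex.exp (logz y k) = p y k)
    {logd : Y → Fin n → Fin n → ℂ} (hlogd : ∀ k l, k < l → Continuous fun y => logd y k l)
    (hlogd_exp : ∀ y k l, k < l → Complex.exp (logd y k l) = p y k - p y l)
    {s : OpenPartialHomeomorph Y (Fin n → ℂ)} (hs : ⇑s = p) {y : Y} (hy : y ∈ s.source)
    (lam : H) (k : Fin n) :
    HasDerivAt (fun t => D.zExponent V ν κ (logz (lineLift p s y k t)) (logd (lineLift p s y k t))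
      lam) ((κ * p y k)⁻¹ * LinearMap.trace ℂ _ (res V H ν (D.kzOp V (p y) lam k))) (p y k) := by
  have hx : ∀ k, p y k ≠ 0 := fun k => hlogz_exp y k ▸ Complex.exp_ne_zero _
  have hx' : ∀ k l, k ≠ l → p y k ≠ p y l := by
    intro k l hkl
    rcases lt_or_gt_of_ne hkl with h | h
    · exact sub_ne_zero.1 (hlogd_exp y k l h ▸ Complex.exp_ne_zero _)
    · exact (sub_ne_zero.1 (hlogd_exp y l k h ▸ Complex.exp_ne_zero _)).symm
  rw [D.trace_kzOp V ν hx hx']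
  have h1 := HasDerivAt.fun_sum (u := Finset.univ) fun l _ =>
    (hasDerivAt_logz hs hy k hlogz hlogz_exp l).mul_const
      (Lam V D ν l lam / κ - D.gam V ν l / (2 * κ))
  have h2 := HasDerivAt.fun_sum (u := Finset.univ) fun a _ =>
    HasDerivAt.fun_sum (u := Finset.univ.filter (a < ·)) fun b hb =>
      (hasDerivAt_logd hs hy k (hlogd a b (Finset.mem_filter.1 hb).2)
        (fun y => hlogd_exp y a b (Finset.mem_filter.1 hb).2)).mul_const (D.eps V ν a b / κ)
  refine (h1.add h2).congr_deriv ?_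
  have h3 : ∑ l, (if l = k then (1 : ℂ) else 0) / p y l *
      (Lam V D ν l lam / κ - D.gam V ν l / (2 * κ)) =
        1 / p y k * (Lam V D ν k lam / κ - D.gam V ν k / (2 * κ)) := by
    rw [Finset.sum_eq_single k]
    · simp
    · intro l _ hl
      simp [hl]
    · simp
  -- only the pairs containing `k` contribute
  have h4 : ∑ a, ∑ b ∈ Finset.univ.filter (a < ·),
      ((if a = k then (1 : ℂ) else 0) - (if b = k then 1 else 0)) / (p y a - p y b) *
        (D.eps V ν a b / κ) =
      ∑ l ∈ Finset.univ.filter (· ≠ k), D.eps V ν k l / (p y k - p y l) / κ := by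
    have h5 : ∀ a b : Fin n,
        ((if a = k then (1 : ℂ) else 0) - (if b = k then 1 else 0)) / (p y a - p y b) *
          (D.eps V ν a b / κ) =
        (if a = k then D.eps V ν a b / (p y a - p y b) / κ else 0) +
          (if b = k then D.eps V ν a b / (p y b - p y a) / κ else 0) := by
      intro a b
      have h6 : p y b - p y a = -(p y a - p y b) := by ring
      rw [h6, div_neg]
      split_ifs <;> ring
    simp only [h5, Finset.sum_add_distrib, Finset.sum_filter]
    have h7 : ∀ a : Fin n, (∑ b, if a < b then
        (if a = k then D.eps V ν a b / (p y a - p y b) / κ else 0) else 0) =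
        if a = k then ∑ b, (if k < b then D.eps V ν k b / (p y k - p y b) / κ else 0) else 0 := by
      intro a
      split_ifs with ha
      · subst ha; rfl
      · simp
    have h8 : ∀ a : Fin n, (∑ b, if a < b then
        (if b = k then D.eps V ν a b / (p y b - p y a) / κ else 0) else 0) =
        if a < k then D.eps V ν k a / (p y k - p y a) / κ else 0 := by
      intro a
      rw [Finset.sum_eq_single k]
      · by_cases ha : a < k
        · simp [ha, D.eps_symm V ν ha.ne]
        · simp [ha]
      · intro b _ hb
        simp [hb]
      · simp
    simp only [h7, h8, Finset.sum_ite_eq', Finset.mem_univ, if_true, ← Finset.sum_add_distrib]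
    refine Finset.sum_congr rfl fun l _ => ?_
    rcases lt_trichotomy k l with h | h | h
    · simp [h, h.ne', h.not_gt]
    · simp [h]
    · simp [h, h.ne, h.not_gt]
  rw [h3, h4, ← Finset.sum_div]
  have := hx k
  field_simp
  ring

/-- A determinant of solutions of the KZ equations is the product of `exp` of `zExponent` and of a
function of `λ`. -/
lemma exists_det_eq [PreconnectedSpace Y] (ν : Dual ℂ H) {d : ℕ}
    (v : Basis (Fin d) ℂ (weightSubspace V H ν)) {κ : ℂ} (hκ : κ ≠ 0) (hp : IsLocalHomeomorph p)
    {logz : Y → Fin n → ℂ} (hlogz : Continuous logz)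
    (hlogz_exp : ∀ y k, Complex.exp (logz y k) = p y k)
    {logd : Y → Fin n → Fin n → ℂ} (hlogd : ∀ k l, k < l → Continuous fun y => logd y k l)
    (hlogd_exp : ∀ y k l, k < l → Complex.exp (logd y k l) = p y k - p y l)
    {S : Set H} {u : Fin d → Y → H → weightSubspace V H ν}
    (hKZ : ∀ i, SolvesKZ V D ν κ p S (u i)) {lam : H} (hlam : lam ∈ S) :
    ∀ y y', Matrix.det (Matrix.of fun i j => v.repr (u i y lam) j) *
        Complex.exp (-D.zExponent V ν κ (logz y) (logd y) lam) =
      Matrix.det (Matrix.of fun i j => v.repr (u i y' lam) j) *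
        Complex.exp (-D.zExponent V ν κ (logz y') (logd y') lam) := by
  refine fun y y' => (isLocallyConstant_of_hasDerivAt_zero hp (G := fun y =>
    Matrix.det (Matrix.of fun i j => v.repr (u i y lam) j) *
      Complex.exp (-D.zExponent V ν κ (logz y) (logd y) lam)) ?_).apply_eq_of_preconnectedSpace y y'
  intro s hs y hy k
  set A : End ℂ (weightSubspace V H ν) := (κ * p y k)⁻¹ • res V H ν (D.kzOp V (p y) lam k) with hA
  have hx : κ * p y k ≠ 0 := mul_ne_zero hκ (hlogz_exp y k ▸ Complex.exp_ne_zero _)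
  let M : ℂ → Matrix (Fin d) (Fin d) ℂ := fun t =>
    Matrix.of fun i j => v.repr (u i (lineLift p s y k t) lam) j
  have hM : ∀ i j, HasDerivAt (fun t => M t i j)
      ((M (p y k) * (LinearMap.toMatrix v v A).transpose) i j) (p y k) := by
    intro i j
    obtain ⟨w, hw, heq⟩ := hKZ i lam hlam y k
    have hw' : w = A (u i y lam) := by
      refine Subtype.ext ?_
      rw [hA, LinearMap.smul_apply, Submodule.coe_smul, coe_res V (D.kzOp_mem V ν _ _ _),
        eq_inv_smul_iff₀ hx, heq, kzOp, LinearMap.add_apply]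
    refine (hw.hasDerivAt k hs hy (v.coord j)).congr_deriv ?_
    have h1 : (LinearMap.toMatrix v v A).mulVec (v.repr (u i y lam)) = v.repr w := by
      rw [LinearMap.toMatrix_mulVec_repr, hw']
    rw [Basis.coord_apply, ← h1, Matrix.mul_apply, Matrix.mulVec, dotProduct]
    refine Finset.sum_congr rfl fun m _ => ?_
    simp only [M, Matrix.of_apply, Matrix.transpose_apply, lineLift_self hs hy, mul_comm]
  have h1 := hasDerivAt_det hM
  have h2 := D.hasDerivAt_zExponent V ν hκ hlogz hlogz_exp hlogd hlogd_exp hs hy lam k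
  refine (h1.mul h2.neg.cexp).congr_deriv ?_
  have h3 : ((M (p y k)).adjugate * (M (p y k) * (LinearMap.toMatrix v v A).transpose)).trace =
      (M (p y k)).det * ((κ * p y k)⁻¹ *
        LinearMap.trace ℂ _ (res V H ν (D.kzOp V (p y) lam k))) := by
    rw [← Matrix.mul_assoc, Matrix.adjugate_mul, Matrix.smul_mul, Matrix.one_mul, Matrix.trace_smul,
      Matrix.trace_transpose, ← LinearMap.trace_eq_matrix_trace ℂ v, hA, map_smul, smul_eq_mul,
      smul_eq_mul]
  rw [h3]
  ring

/-! ### The dynamical equations for the determinant -/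

lemma det_repr_map {W : Type*} [AddCommGroup W] [Module ℂ W] {d : ℕ} (v : Basis (Fin d) ℂ W)
    (A : End ℂ W) (w : Fin d → W) :
    Matrix.det (Matrix.of fun i j => v.repr (A (w i)) j) =
      LinearMap.det A * Matrix.det (Matrix.of fun i j => v.repr (w i) j) := by
  have h : ∀ w : Fin d → W, Matrix.det (Matrix.of fun i j => v.repr (w i) j) = v.det w := by
    intro w
    rw [Basis.det_apply, ← Matrix.det_transpose]
    rfl
  rw [h fun i => A (w i), h w]
  exact v.det_comp A w

/-- A determinant of solutions of the dynamical equations and `detFun` are multiplied by the same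
factor under `λ ↦ λ + κ ω_i^∨`. -/
lemma exists_common_factor (ν : Dual ℂ H) {d : ℕ}
    (v : Basis (Fin d) ℂ (weightSubspace V H ν)) {κ : ℂ} (hκ : κ ≠ 0) {Y : Type*}
    {logz : Y → Fin n → ℂ} (logd : Fin n → Fin n → ℂ)
    {word : D.base.support → List (Option D.base.support)}
    (hword : ∀ i, D.IsReducedPresentation (D.fundCoweight i) (word i))
    {S : Set H} (hS : ∀ lam ∈ S, D.IsRegular V ν κ lam)
    {u : Fin d → Y → H → weightSubspace V H ν}
    (hdyn : ∀ i, SolvesDynamical V D ν κ logz word S (u i)) (y : Y) {lam : H} (hlam : lam ∈ S)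
    (i : D.base.support) :
    ∃ q : ℂ,
      Matrix.det (Matrix.of fun a b => v.repr (u a y (lam + κ • D.fundCoweight i)) b) =
        q * Matrix.det (Matrix.of fun a b => v.repr (u a y lam) b) ∧
      D.detFun V ν κ (logz y) logd (lam + κ • D.fundCoweight i) =
        q * D.detFun V ν κ (logz y) logd lam := by
  set B := ∏ α ∈ D.posRoots, ∏ j ∈ Finset.range (D.level i α), D.bDet V ν α (D.rt α lam + κ * j)
    with hB
  set e := ∑ k, logz y k * Lam V D ν k (D.fundCoweight i) with he
  refine ⟨Complex.exp e * B, ?_, ?_⟩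
  · have h1 : ∀ a, res V H ν (zPow V (logz y) (-D.fundCoweight i))
        (u a y (lam + κ • D.fundCoweight i)) =
          res V H ν (D.GWord V ν κ (logz y) lam (word i)) (u a y lam) := by
      intro a
      refine Subtype.ext ?_
      rw [coe_res V (zPow_mem V ν _ _), coe_res V (D.GWord_mem V ν κ _ _ _)]
      exact hdyn a lam hlam y i
    have h2 := det_repr_map v (res V H ν (zPow V (logz y) (-D.fundCoweight i)))
      fun a => u a y (lam + κ • D.fundCoweight i)
    simp only [h1] at h2
    rw [det_repr_map v, D.det_res_GWord V ν κ (logz y) (hS lam hlam) (hword i), ← hB,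
      D.det_res_zPow V ν] at h2
    have h3 : ∑ k, logz y k * Lam V D ν k (-D.fundCoweight i) = -e := by
      simp only [Lam_neg, mul_neg, Finset.sum_neg_distrib, he]
    rw [h3, Complex.exp_neg, inv_mul_eq_div, eq_comm, div_eq_iff (Complex.exp_ne_zero _)] at h2
    rw [h2]
    ring
  · have h1 : D.zExponent V ν κ (logz y) logd (lam + κ • D.fundCoweight i) =
        e + D.zExponent V ν κ (logz y) logd lam := by
      have h2 : ∀ k, logz y k *
          (Lam V D ν k (lam + κ • D.fundCoweight i) / κ - D.gam V ν k / (2 * κ)) =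
            logz y k * Lam V D ν k (D.fundCoweight i) +
              logz y k * (Lam V D ν k lam / κ - D.gam V ν k / (2 * κ)) := by
        intro k
        rw [Lam_add_smul]
        field_simp
        ring
      rw [zExponent, zExponent, Finset.sum_congr rfl fun k _ => h2 k, Finset.sum_add_distrib, he,
        add_assoc]
    rw [detFun_eq, detFun_eq, h1, Complex.exp_add, D.prod_X_shift V ν hκ (hS lam hlam) i, ← hB]
    ring

/-- The dominant elements `∑ m_i ω_i^∨`, `m_i ∈ ℕ`, of the dual weight lattice. -/
def dominant : AddSubmonoid H := AddSubmonoid.closure (Set.range D.fundCoweight)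

lemma dominant_le {ω : H} (hω : ω ∈ D.dominant) : ω ∈ D.coweightLattice := by
  have h : D.dominant ≤ D.coweightLattice.toAddSubmonoid :=
    AddSubmonoid.closure_le.2 Submodule.subset_span
  exact h hω

/-- Every element of the dual weight lattice becomes dominant after adding a multiple of `ρ^∨`. -/
lemma exists_add_rhoVec_mem_dominant {ω : H} (hω : ω ∈ D.coweightLattice) :
    ∃ N : ℕ, ∀ m ≥ N, ω + m • D.rhoVec ∈ D.dominant := by
  obtain ⟨c, rfl⟩ := (Submodule.mem_span_range_iff_exists_fun ℤ).1 hω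
  refine ⟨∑ i, (c i).natAbs, fun m hm => ?_⟩
  rw [rhoVec, Finset.smul_sum, ← Finset.sum_add_distrib]
  refine sum_mem fun i _ => ?_
  have h1 : (c i).natAbs ≤ m :=
    (Finset.single_le_sum (f := fun i => (c i).natAbs) (fun _ _ => Nat.zero_le _)
      (Finset.mem_univ i)).trans hm
  obtain ⟨k, hk⟩ := Int.eq_ofNat_of_zero_le (a := c i + m) (by omega)
  rw [← natCast_zsmul, ← add_smul, hk, natCast_zsmul]
  exact nsmul_mem (AddSubmonoid.subset_closure (Set.mem_range_self i)) k

/-- Two functions multiplied by common factors under the translations by `κ ω_i^∨`, the second of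
which is non-zero far away in the antidominant direction, have a periodic quotient. The second
function may have zeros, so the quotient is formed at a point of each orbit where it is not zero. -/
lemma exists_periodic_quotient {κ : ℂ} {S : Set H}
    (hS_inv : ∀ lam ∈ S, ∀ ω ∈ D.coweightLattice, lam + κ • ω ∈ S) {f g : H → ℂ}
    (hstep : ∀ lam ∈ S, ∀ i, ∃ q : ℂ, f (lam + κ • D.fundCoweight i) = q * f lam ∧
      g (lam + κ • D.fundCoweight i) = q * g lam)
    (hne : ∀ lam ∈ S, ∀ᶠ m : ℕ in Filter.atTop, g (lam - κ • m • D.rhoVec) ≠ 0) :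
    ∃ C : H → ℂ, (∀ lam, ∀ ω ∈ D.coweightLattice, C (lam + κ • ω) = C lam) ∧
      ∀ lam ∈ S, f lam = C lam * g lam := by
  have hdom : ∀ ω ∈ D.dominant, ∀ lam ∈ S, ∃ q : ℂ, f (lam + κ • ω) = q * f lam ∧
      g (lam + κ • ω) = q * g lam := by
    intro ω hω
    induction hω using AddSubmonoid.closure_induction with
    | mem x hx =>
      obtain ⟨i, rfl⟩ := hx
      exact fun lam hlam => hstep lam hlam i
    | zero => exact fun lam _ => ⟨1, by simp, by simp⟩
    | add x y hx _ ihx ihy =>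
      intro lam hlam
      obtain ⟨q, h1, h2⟩ := ihx lam hlam
      obtain ⟨q', h3, h4⟩ := ihy _ (hS_inv lam hlam x (D.dominant_le hx))
      refine ⟨q' * q, ?_, ?_⟩
      · rw [smul_add, ← add_assoc, h3, h1, mul_assoc]
      · rw [smul_add, ← add_assoc, h4, h2, mul_assoc]
  -- two points of an orbit are both reached from a point far below
  have hcross : ∀ lam ∈ S, ∀ ω ∈ D.coweightLattice,
      f lam * g (lam + κ • ω) = f (lam + κ • ω) * g lam := by
    intro lam hlam ω hω
    obtain ⟨N, hN⟩ := D.exists_add_rhoVec_mem_dominant hω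
    have hρ : N • D.rhoVec ∈ D.coweightLattice := nsmul_mem D.rhoVec_mem N
    obtain ⟨N', hN'⟩ := D.exists_add_rhoVec_mem_dominant (Submodule.zero_mem D.coweightLattice)
    set m := max N N'
    have hm : m • D.rhoVec ∈ D.coweightLattice := nsmul_mem D.rhoVec_mem m
    have hm0 : m • D.rhoVec ∈ D.dominant := by simpa using hN' m (le_max_right _ _)
    have hlow := hS_inv lam hlam _ (neg_mem hm)
    obtain ⟨q, h1, h2⟩ := hdom _ hm0 _ hlow
    obtain ⟨q', h3, h4⟩ := hdom _ (hN m (le_max_left _ _)) _ hlow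
    have e1 : lam + κ • -(m • D.rhoVec) + κ • m • D.rhoVec = lam := by module
    have e2 : lam + κ • -(m • D.rhoVec) + κ • (ω + m • D.rhoVec) = lam + κ • ω := by module
    rw [e1] at h1 h2
    rw [e2] at h3 h4
    rw [h1, h2, h3, h4]
    ring
  let Z : H → Set H := fun lam => {c | c ∈ S ∧ g c ≠ 0 ∧ ∃ ω ∈ D.coweightLattice, c = lam + κ • ω}
  have hZ : ∀ lam, ∀ ω ∈ D.coweightLattice, Z (lam + κ • ω) = Z lam := by
    intro lam ω hω
    ext c
    constructor
    · rintro ⟨h1, h2, ω', hω', rfl⟩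
      exact ⟨h1, h2, ω + ω', add_mem hω hω', by module⟩
    · rintro ⟨h1, h2, ω', hω', rfl⟩
      exact ⟨h1, h2, ω' - ω, sub_mem hω' hω, by module⟩
  refine ⟨fun lam => f (Classical.epsilon (· ∈ Z lam)) / g (Classical.epsilon (· ∈ Z lam)),
    fun lam ω hω => by simp only [hZ lam ω hω], fun lam hlam => ?_⟩
  have hex : ∃ c, c ∈ Z lam := by
    obtain ⟨m, hm⟩ := (hne lam hlam).exists
    have hmem : -(m • D.rhoVec) ∈ D.coweightLattice := neg_mem (nsmul_mem D.rhoVec_mem m)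
    have he : lam - κ • m • D.rhoVec = lam + κ • -(m • D.rhoVec) := by module
    rw [he] at hm
    exact ⟨_, hS_inv lam hlam _ hmem, hm, _, hmem, rfl⟩
  obtain ⟨-, hg, ω, hω, hc⟩ := Classical.epsilon_spec hex
  rw [eq_comm, div_mul_eq_mul_div, div_eq_iff hg, hc]
  exact (hcross lam hlam ω hω).symm

end RootData

end Operators

end KZDyn

end

theorem mainTheorem4
    -- a simple Lie algebra, a Cartan subalgebra, simple roots, a scalar product, root vectors
    {L : Type*} [LieRing L] [LieAlgebra ℂ L] [FiniteDimensional ℂ L] [LieAlgebra.IsSimple ℂ L]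
    (H : LieSubalgebra ℂ L) [H.IsCartanSubalgebra] (D : KZDyn.RootData H)
    -- finite dimensional modules, a weight subspace, a basis of it, and the step
    {n : ℕ} (V : Fin n → Type*) [∀ k, AddCommGroup (V k)] [∀ k, Module ℂ (V k)]
    [∀ k, LieRingModule L (V k)] [∀ k, LieModule ℂ L (V k)] [∀ k, FiniteDimensional ℂ (V k)]
    (ν : Module.Dual ℂ H) (d : ℕ) (v : Module.Basis (Fin d) ℂ (KZDyn.weightSubspace V H ν))
    (κ : ℂ) (hκ : κ ≠ 0)
    -- a connected space spread over the points with distinct non-zero coordinates (for example the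
    -- universal cover), on which branches of `log z_k` and of `log (z_k - z_l)` are fixed
    {Y : Type*} [TopologicalSpace Y] [PreconnectedSpace Y] (p : Y → Fin n → ℂ)
    (hp : IsLocalHomeomorph p)
    (logz : Y → Fin n → ℂ) (hlogz : Continuous logz)
    (hlogz_exp : ∀ y k, Complex.exp (logz y k) = p y k)
    (logd : Y → Fin n → Fin n → ℂ) (hlogd : ∀ k l, k < l → Continuous fun y => logd y k l)
    (hlogd_exp : ∀ y k l, k < l → Complex.exp (logd y k l) = p y k - p y l)
    -- reduced presentations of the translations by the dual fundamental weights
    (word : D.base.support → List (Option D.base.support))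
    (hword : ∀ i, D.IsReducedPresentation (D.fundCoweight i) (word i))
    -- a set of regular `λ`, invariant under the translations by `κ P^∨`
    (S : Set H) (hS : ∀ lam ∈ S, D.IsRegular V ν κ lam)
    (hS_inv : ∀ lam ∈ S, ∀ ω ∈ D.coweightLattice, lam + κ • ω ∈ S)
    -- `d` solutions of the combined system
    (u : Fin d → Y → H → KZDyn.weightSubspace V H ν)
    (hKZ : ∀ i, KZDyn.SolvesKZ V D ν κ p S (u i))
    (hdyn : ∀ i, KZDyn.SolvesDynamical V D ν κ logz word S (u i)) :
    ∃ C : H → ℂ,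
      (∀ lam, ∀ ω ∈ D.coweightLattice, C (lam + κ • ω) = C lam) ∧
      ∀ y, ∀ lam ∈ S,
        Matrix.det (Matrix.of fun i j => v.repr (u i y lam) j) =
          C lam * D.detFun V ν κ (logz y) (logd y) lam := by
  rcases isEmpty_or_nonempty Y with hY | ⟨⟨y₀⟩⟩
  · exact ⟨0, fun _ _ _ => rfl, fun y => isEmptyElim y⟩
  obtain ⟨C, hC, hdet⟩ := D.exists_periodic_quotient hS_inv
    (f := fun lam => Matrix.det (Matrix.of fun i j => v.repr (u i y₀ lam) j))
    (g := fun lam => D.detFun V ν κ (logz y₀) (logd y₀) lam)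
    (fun lam hlam i => D.exists_common_factor V ν v hκ (logd y₀) hword hS hdyn y₀ hlam i)
    (fun lam hlam => by
      filter_upwards [D.eventually_prod_X_ne_zero V ν hκ (hS lam hlam)] with m hm
      rw [KZDyn.RootData.detFun_eq]
      exact mul_ne_zero (Complex.exp_ne_zero _) hm)
  refine ⟨C, hC, fun y lam hlam => ?_⟩
  have h1 := D.exists_det_eq V ν v hκ hp hlogz hlogz_exp hlogd hlogd_exp hKZ hlam y y₀
  rw [hdet lam hlam, KZDyn.RootData.detFun_eq, Complex.exp_neg, Complex.exp_neg,
    mul_inv_eq_iff_eq_mul₀ (Complex.exp_ne_zero _)] at h1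
  rw [h1, KZDyn.RootData.detFun_eq]
  have := Complex.exp_ne_zero (D.zExponent V ν κ (logz y₀) (logd y₀) lam)
  field_simp
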